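/- Let $\operatorname{ED}(A,B)$ denote the edit distance of two strings: the least number of insertions, deletions and substitutions of single characters that turn $A$ into $B$. There are a single randomized word-RAM algorithm and an absolute constant $e$ such that for every constant $K$ there are constants $C$ and $c$ with the following property. Let $n\ge 1$ and $k\ge 1$ be integers with $k\le K\sqrt n$, let $\Sigma=\{1,\dots,\sigma\}$ be a finite alphabet, and let the words of the machine have $w\ge c\,(\lfloor\log_2 n\rfloor+\lfloor\log_2\sigma\rfloor+1)$ bits. Given $n$, $k$, $\sigma$ and unit-cost random access to the characters of $A,B\in\Sigma^n$ (and no preprocessing of $A$ or $B$), the algorithm always halts with the answer SMALL or LARGE within $$C\cdot\frac{n}{\sqrt k}\cdot\bigl(\log(n+1)\bigr)^{e}=\tilde O\!\left(\frac{n}{\sqrt k}\right)$$ steps, and for all $A,B\in\Sigma^n$, over its random words: * if $\operatorname{ED}(A,B)\le k$, it answers SMALL with probability at least $1-\frac1n$; * if $\operatorname{ED}(A,B)>40k^2$, it answers LARGE with probability at least $1-\frac1n$. -/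

import Mathlib

/-- Edit (Levenshtein) distance: the least number of insertions, deletions and substitutions of
single characters that turn the first string into the second. -/
def editDist {α : Type*} [DecidableEq α] : List α → List α → ℕ
  | [], ys => ys.length
  | _ :: xs, [] => xs.length + 1
  | x :: xs, y :: ys =>
      min (editDist xs (y :: ys) + 1)
        (min (editDist (x :: xs) ys + 1) (editDist xs ys + if x = y then 0 else 1))
termination_by xs ys => xs.length + ys.length

/-- Edit distance of two strings of length `n`. -/
def ED {n σ : ℕ} (A B : Fin n → Fin σ) : ℕ := editDist (List.ofFn A) (List.ofFn B)

/-! ### A randomized word RAM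

Programs of a small imperative language over words of `w` bits, that is, natural numbers below
`2 ^ w`. A program mentions finitely many registers and finitely many arrays; an array is
addressed by a word and holds words. The two input strings can be read at any position at unit
cost, and one instruction draws a uniformly random word. -/

namespace WordRAM

/-- Binary operations of the machine on words. -/
inductive Op
  | add | sub | mul | div | mod | lt | eq

/-- Value of an operation before it is reduced to a word: `sub` is truncated at `0`, `div` and
`mod` are quotient and remainder, `lt` and `eq` return `1` for true and `0` for false. -/
def Op.apply : Op → ℕ → ℕ → ℕ
  | .add, a, b => a + b
  | .sub, a, b => a - b
  | .mul, a, b => a * b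
  | .div, a, b => a / b
  | .mod, a, b => a % b
  | .lt, a, b => if a < b then 1 else 0
  | .eq, a, b => if a = b then 1 else 0

/-- Expressions. `load a e` is the entry of array `a` at address `e`; `charA e` and `charB e` read
position `e` of the first and of the second input string. -/
inductive Expr
  | lit (c : ℕ)
  | reg (x : ℕ)
  | bin (o : Op) (e₁ e₂ : Expr)
  | load (a : ℕ) (e : Expr)
  | charA (e : Expr)
  | charB (e : Expr)

/-- Cost of evaluating an expression: one unit per literal, register, operation and access. -/
def Expr.cost : Expr → ℕ
  | .lit _ => 1
  | .reg _ => 1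
  | .bin _ e₁ e₂ => e₁.cost + e₂.cost + 1
  | .load _ e => e.cost + 1
  | .charA e => e.cost + 1
  | .charB e => e.cost + 1

/-- Programs. -/
inductive Prog
  | skip
  | assign (x : ℕ) (e : Expr)
  | store (a : ℕ) (i e : Expr)
  | rand (x : ℕ)
  | seq (P Q : Prog)
  | ite (e : Expr) (P Q : Prog)
  | while (e : Expr) (P : Prog)

/-- What a run is given and cannot change: the word length, the two input strings (as functions of
the position) and the tape of random words. -/
structure Env where
  w : ℕ
  strA : ℕ → ℕ
  strB : ℕ → ℕ
  tape : ℕ → ℕ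

/-- Registers, arrays, and the number of random words used so far. -/
structure State where
  reg : ℕ → ℕ
  arr : ℕ → ℕ → ℕ
  pos : ℕ

/-- Value of an expression; every result is reduced modulo `2 ^ w`. -/
def Expr.eval (E : Env) (s : State) : Expr → ℕ
  | .lit c => c % 2 ^ E.w
  | .reg x => s.reg x
  | .bin o e₁ e₂ => o.apply (e₁.eval E s) (e₂.eval E s) % 2 ^ E.w
  | .load a e => s.arr a (e.eval E s)
  | .charA e => E.strA (e.eval E s) % 2 ^ E.w
  | .charB e => E.strB (e.eval E s) % 2 ^ E.w

/-- State after writing `v` to register `x`. -/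
def State.setReg (s : State) (x v : ℕ) : State :=
  { s with reg := Function.update s.reg x v }

/-- State after writing `v` to address `i` of array `a`. -/
def State.setArr (s : State) (a i v : ℕ) : State :=
  { s with arr := Function.update s.arr a (Function.update (s.arr a) i v) }

/-- `Exec E P s t s'`: started in state `s`, the program `P` halts in state `s'` after exactly `t`
steps. -/
inductive Exec (E : Env) : Prog → State → ℕ → State → Prop
  | skip (s : State) : Exec E .skip s 1 s
  | assign (s : State) (x : ℕ) (e : Expr) :
      Exec E (.assign x e) s (e.cost + 1) (s.setReg x (e.eval E s))
  | store (s : State) (a : ℕ) (i e : Expr) :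
      Exec E (.store a i e) s (i.cost + e.cost + 1) (s.setArr a (i.eval E s) (e.eval E s))
  | rand (s : State) (x : ℕ) :
      Exec E (.rand x) s 1 { s.setReg x (E.tape s.pos) with pos := s.pos + 1 }
  | seq {P Q : Prog} {s s₁ s₂ : State} {t₁ t₂ : ℕ} :
      Exec E P s t₁ s₁ → Exec E Q s₁ t₂ s₂ → Exec E (.seq P Q) s (t₁ + t₂) s₂
  | iteTrue {e : Expr} {P Q : Prog} {s s₁ : State} {t : ℕ} :
      e.eval E s ≠ 0 → Exec E P s t s₁ → Exec E (.ite e P Q) s (e.cost + 1 + t) s₁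
  | iteFalse {e : Expr} {P Q : Prog} {s s₁ : State} {t : ℕ} :
      e.eval E s = 0 → Exec E Q s t s₁ → Exec E (.ite e P Q) s (e.cost + 1 + t) s₁
  | whileTrue {e : Expr} {P : Prog} {s s₁ s₂ : State} {t₁ t₂ : ℕ} :
      e.eval E s ≠ 0 → Exec E P s t₁ s₁ → Exec E (.while e P) s₁ t₂ s₂ →
      Exec E (.while e P) s (e.cost + 1 + t₁ + t₂) s₂
  | whileFalse {e : Expr} {P : Prog} {s : State} :
      e.eval E s = 0 → Exec E (.while e P) s (e.cost + 1) s

/-- A string as the machine sees it: positions are `0, …, n - 1`, the characters are coded as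
`1, …, σ`, and every position out of range holds the extra symbol `0`. -/
def readString {n σ : ℕ} (A : Fin n → Fin σ) (i : ℕ) : ℕ :=
  if h : i < n then (A ⟨i, h⟩ : ℕ) + 1 else 0

/-- The environment for inputs `A`, `B`, word length `w` and random words `ω`; a run of at most `T`
steps reads at most the first `T` words of the tape. -/
def env {n σ T : ℕ} (w : ℕ) (A B : Fin n → Fin σ) (ω : Fin T → Fin (2 ^ w)) : Env where
  w := w
  strA := readString A
  strB := readString B
  tape i := if h : i < T then (ω ⟨i, h⟩ : ℕ) else 0

/-- The initial state: `n`, `k` and `σ` in registers `0`, `1`, `2`; all else is zero. -/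
def init (w n k σ : ℕ) : State where
  reg x := if x = 0 then n % 2 ^ w else if x = 1 then k % 2 ^ w
    else if x = 2 then σ % 2 ^ w else 0
  arr _ _ := 0
  pos := 0

/-- With random words `ω`, the program halts within `T` steps with the answer `r` in
register `0`. -/
def Answers {n σ T : ℕ} (P : Prog) (w k : ℕ) (A B : Fin n → Fin σ) (r : ℕ)
    (ω : Fin T → Fin (2 ^ w)) : Prop :=
  ∃ t ≤ T, ∃ s : State, Exec (env w A B ω) P (init w n k σ) t s ∧ s.reg 0 = r

/-- Probability, over `T` independent uniformly random words, that the program answers `r` within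
`T` steps. -/
noncomputable def answerProb {n σ : ℕ} (P : Prog) (w k T : ℕ) (A B : Fin n → Fin σ) (r : ℕ) : ℝ :=
  (Nat.card {ω : Fin T → Fin (2 ^ w) // Answers P w k A B r ω} : ℝ) /
    Nat.card (Fin T → Fin (2 ^ w))

/-- The answer `the distance is large`. -/
def LARGE : ℕ := 0

/-- The answer `the distance is small`. -/
def SMALL : ℕ := 1

end WordRAM

/-!
A greedy scan splits the strings into rounds. The round at `i` is the longest window
`i, …, i + l - 1` that passes a test: some diagonal within distance about `k` of the main one shows
no mismatch on a set of random samples, taken at a rate of about `log n / k`. If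
`ED A B ≤ k`, an optimal alignment has an edit in every window that fails, so that at most `k`
rounds end inside the strings. With probability at least `1 - 1 / n`, by a union bound, the samples
reveal every diagonal with more than `k` mismatches in any window; then every round adds only `O(k)`
to the edit distance, and `k + 1` rounds that exhaust the strings show `ED A B = O(k ^ 2)`.

The `2 * k + 1` diagonals are tested together by baby steps and giant steps: every one of them is a
difference `a * r - b` with `b < r ≈ √k`, so `A` is read at `r` offsets and `B` at
`O(k / r) = O(r)` offsets, and a trie detects a common sample sequence. A window of length `l` thus
costs about `r * (l / k + 1) * log n`. The length of a round is found by doubling and bisection,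
where no test is on a window of more than about twice that length; as the windows are disjoint and
there are `O(k)` of them, the total is `Õ(r * (n / k + k)) = Õ(n / √k)`. If `n ≤ 40 * k ^ 2`, then
`SMALL` is always correct.
-/

section EditDist

variable {α : Type*} [DecidableEq α]

theorem editDist_nil_left (ys : List α) : editDist [] ys = ys.length := by
  simp only [editDist]

theorem editDist_nil_right (xs : List α) : editDist xs [] = xs.length := by
  cases xs <;> simp only [editDist, List.length_nil, List.length_cons]

theorem editDist_cons_cons (x y : α) (xs ys : List α) :
    editDist (x :: xs) (y :: ys) =
      min (editDist xs (y :: ys) + 1)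
        (min (editDist (x :: xs) ys + 1) (editDist xs ys + if x = y then 0 else 1)) := by
  rw [editDist]

theorem editDist_le_tail_left (xs ys : List α) : editDist xs ys ≤ editDist xs.tail ys + 1 := by
  rcases xs with _ | ⟨x, xs⟩
  · exact Nat.le_succ _
  rcases ys with _ | ⟨y, ys⟩
  · simp only [editDist_nil_right, List.length_cons, List.tail_cons, le_refl]
  · rw [editDist_cons_cons]
    exact min_le_left _ _

theorem editDist_le_tail_right (xs ys : List α) : editDist xs ys ≤ editDist xs ys.tail + 1 := by
  rcases ys with _ | ⟨y, ys⟩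
  · exact Nat.le_succ _
  rcases xs with _ | ⟨x, xs⟩
  · simp only [editDist_nil_left, List.length_cons, List.tail_cons, le_refl]
  · rw [editDist_cons_cons]
    exact (min_le_right _ _).trans (min_le_left _ _)

theorem editDist_tail_right_le (xs ys : List α) : editDist xs ys.tail ≤ editDist xs ys + 1 := by
  rcases ys with _ | ⟨y, ys⟩
  · exact Nat.le_succ _
  induction xs with
  | nil => simp only [editDist_nil_left, List.length_cons, List.tail_cons]; omega
  | cons x xs ih =>
    have h := editDist_le_tail_left (x :: xs) ys
    rw [editDist_cons_cons]
    simp only [List.tail_cons] at h ih ⊢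
    omega

theorem editDist_le_tail_tail (xs ys : List α) :
    editDist xs ys ≤ editDist xs.tail ys.tail + if xs.head? = ys.head? then 0 else 1 := by
  rcases xs with _ | ⟨x, xs⟩ <;> rcases ys with _ | ⟨y, ys⟩
  · exact Nat.le_add_right _ _
  · exact editDist_le_tail_right [] (y :: ys)
  · exact editDist_le_tail_left (x :: xs) []
  · simp only [List.head?_cons, Option.some_inj, List.tail_cons, editDist_cons_cons]
    exact (min_le_right _ _).trans (min_le_right _ _)

theorem editDist_drop_left (xs ys : List α) (i d : ℕ) :
    editDist (xs.drop i) ys ≤ editDist (xs.drop (i + d)) ys + d := by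
  induction d with
  | zero => exact le_rfl
  | succ d ih =>
    have h := editDist_le_tail_left (xs.drop (i + d)) ys
    rw [List.tail_drop, add_assoc] at h
    exact ih.trans (by omega)

theorem editDist_drop_right (xs ys : List α) {i j d : ℕ} (hij : i ≤ j + d) (hji : j ≤ i + d) :
    editDist xs (ys.drop i) ≤ editDist xs (ys.drop j) + d := by
  have hstep : ∀ j, editDist xs (ys.drop j) ≤ editDist xs (ys.drop (j + 1)) + 1 ∧
      editDist xs (ys.drop (j + 1)) ≤ editDist xs (ys.drop j) + 1 := fun j => by
    rw [← List.tail_drop]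
    exact ⟨editDist_le_tail_right _ _, editDist_tail_right_le _ _⟩
  have hadd : ∀ j d, editDist xs (ys.drop j) ≤ editDist xs (ys.drop (j + d)) + d ∧
      editDist xs (ys.drop (j + d)) ≤ editDist xs (ys.drop j) + d := fun j d => by
    induction d with
    | zero => exact ⟨le_rfl, le_rfl⟩
    | succ d ih =>
      have h := hstep (j + d)
      rw [add_assoc] at h
      omega
  rcases le_total i j with h | h <;> obtain ⟨e, rfl⟩ := Nat.exists_eq_add_of_le h
  · exact (hadd i e).1.trans (by omega)
  · exact (hadd j e).2.trans (by omega)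

/-- An optimal alignment can be cut behind the first `t` characters of `xs`; `q` is the cost of the
part in front of the cut. -/
theorem exists_add_editDist_drop_le (xs ys : List α) {t : ℕ} (ht : t ≤ xs.length) :
    ∃ s ≤ ys.length, ∃ q, q + editDist (xs.drop t) (ys.drop s) ≤ editDist xs ys ∧
      s ≤ t + q ∧ t ≤ s + q ∧ (q = 0 → xs.take t = ys.take s) := by
  induction xs, ys using editDist.induct generalizing t with
  | case1 ys =>
    obtain rfl : t = 0 := Nat.le_zero.1 ht
    exact ⟨0, Nat.zero_le _, 0, by simp⟩
  | case2 x xs =>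
    refine ⟨0, le_rfl, t, ?_, Nat.zero_le _, by omega, by rintro rfl; rfl⟩
    rw [List.drop_nil, editDist_nil_right, editDist_nil_right, List.length_drop]
    omega
  | case3 x xs y ys ih_delete ih_insert ih_match =>
    rcases t with _ | t
    · exact ⟨0, Nat.zero_le _, 0, by simp⟩
    rw [List.length_cons] at ht ⊢
    rw [editDist_cons_cons]
    rcases min_choice (editDist xs (y :: ys) + 1) (min (editDist (x :: xs) ys + 1)
      (editDist xs ys + if x = y then 0 else 1)) with h | h
    · obtain ⟨s, hs, q, hq, hst, hts, -⟩ := ih_delete (Nat.le_of_succ_le_succ ht)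
      exact ⟨s, hs, q + 1, by rw [h, List.drop_succ_cons]; omega, by omega, by omega, nofun⟩
    rcases min_choice (editDist (x :: xs) ys + 1)
      (editDist xs ys + if x = y then 0 else 1) with h' | h'
    · obtain ⟨s, hs, q, hq, hst, hts, -⟩ := ih_insert ht
      refine ⟨s + 1, by omega, q + 1, ?_, by omega, by omega, nofun⟩
      simp only [List.drop_succ_cons] at hq ⊢
      omega
    · obtain ⟨s, hs, q, hq, hst, hts, htake⟩ := ih_match (Nat.le_of_succ_le_succ ht)
      refine ⟨s + 1, by omega, q + if x = y then 0 else 1, ?_, by omega, by omega, fun h0 => ?_⟩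
      · rw [h, h', List.drop_succ_cons, List.drop_succ_cons]
        omega
      · obtain ⟨hq0, hxy⟩ := Nat.add_eq_zero_iff.1 h0
        obtain rfl : x = y := by simpa using hxy
        rw [List.take_succ_cons, List.take_succ_cons, htake hq0]

end EditDist

namespace WordRAM

variable {n σ : ℕ} {A B : Fin n → Fin σ} {i j : ℕ}

theorem readString_eq_zero_iff : readString A i = 0 ↔ n ≤ i := by
  simp [readString]

theorem readString_lt (A : Fin n → Fin σ) (i : ℕ) : readString A i < σ + 1 := by
  unfold readString
  split
  · exact Nat.succ_lt_succ (A _).isLt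
  · exact Nat.succ_pos σ

theorem readString_eq_iff :
    readString A i = readString B j ↔ (List.ofFn A)[i]? = (List.ofFn B)[j]? := by
  rw [List.getElem?_ofFn, List.getElem?_ofFn, readString, readString]
  split_ifs <;> simp [Fin.ext_iff]

end WordRAM

namespace GapED

/-- The characters of `f` read by the samples `R` in the window of length `l` at `i + y`. -/
def sampled (f R : ℕ → ℕ) (i l y j : ℕ) : ℕ := f (i + R j % l + y)

/-- The string `f` moved `k` places to the right. Every diagonal at distance at most `k` from the
main one then becomes an offset between `0` and `2 * k`. -/
def shiftBy (k : ℕ) (f : ℕ → ℕ) (z : ℕ) : ℕ := if k ≤ z then f (z - k) else 0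

theorem shiftBy_lt {k s : ℕ} {f : ℕ → ℕ} (hf : ∀ x, f x < s) (z : ℕ) : shiftBy k f z < s := by
  unfold shiftBy
  split
  · exact hf _
  · exact (Nat.zero_le _).trans_lt (hf 0)

/-- Number of samples for a window of length `l`. -/
def numSamples (k L l : ℕ) : ℕ := (l / k + 1) * L

theorem numSamples_mono (k L : ℕ) {l l' : ℕ} (h : l ≤ l') :
    numSamples k L l ≤ numSamples k L l' :=
  Nat.mul_le_mul_right _ (Nat.add_le_add_right (Nat.div_le_div_right h) _)

theorem numSamples_pos (k l : ℕ) {L : ℕ} (h : 0 < L) : 0 < numSamples k L l :=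
  Nat.mul_pos (Nat.succ_pos _) h

/-- The window of length `l` at `i` passes the test: for some baby step `b` and giant step `a * r`
all the samples of `f` and of the shifted string agree. -/
def Passes (f g : ℕ → ℕ) (k r L : ℕ) (R : ℕ → ℕ) (i l : ℕ) : Prop :=
  ∃ b < r, ∃ a, a * r ≤ 2 * k + r ∧ ∀ j < numSamples k L l,
    sampled f R i l b j = sampled (shiftBy k g) R i l (a * r) j

/-- The round at `i` has length `l`: the window of length `l` passes the test `P` and the next
longer window fails it, or leaves the string of length `n`. Windows read up to `r` further
characters. -/
def IsRound (P : ℕ → ℕ → Prop) (n r i l : ℕ) : Prop :=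
  (l = 0 ∨ i + l + r ≤ n ∧ P i l) ∧ (i + l + 1 + r ≤ n → ¬P i (l + 1))

/-- `g` greedy rounds lead from `0` to `i`, where only the last may leave the string. -/
inductive Rounds (P : ℕ → ℕ → Prop) (n r : ℕ) : ℕ → ℕ → Prop
  | zero : Rounds P n r 0 0
  | succ {g i l : ℕ} :
    Rounds P n r g i → i ≤ n → IsRound P n r i l → Rounds P n r (g + 1) (i + l + 1 + r)

/-- The answer `x` given after greedy rounds: `SMALL` once at most `k + 1` of them have left the
string of length `n`, and `LARGE` when `k + 1` of them have not. -/
def IsGreedyAnswer (P : ℕ → ℕ → Prop) (n k r x : ℕ) : Prop :=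
  ∃ g i, Rounds P n r g i ∧
    (n < i ∧ g ≤ k + 1 ∧ x = WordRAM.SMALL ∨ i ≤ n ∧ g = k + 1 ∧ x = WordRAM.LARGE)

/-- The search for the length of a round below `N` has been narrowed down to `lo, …, hi - 1`. -/
structure Bracket (p : ℕ → Prop) (N lo hi : ℕ) : Prop where
  lo_lt : lo < hi
  hi_le : hi ≤ N
  lo_pass : lo = 0 ∨ p lo
  hi_fail : hi = N ∨ ¬p hi

theorem Bracket.isRound {P : ℕ → ℕ → Prop} {n r i lo hi : ℕ}
    (h : Bracket (P i) (n - (i + r) + 1) lo hi) (hhi : hi ≤ lo + 1) : IsRound P n r i lo := by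
  obtain ⟨hlt, hle, hpass, hfail⟩ := h
  obtain rfl : hi = lo + 1 := by omega
  refine ⟨?_, fun hn => hfail.resolve_left (by omega)⟩
  rcases Nat.eq_zero_or_pos lo with h0 | hpos
  · exact .inl h0
  · exact hpass.imp_right fun hp => ⟨by omega, hp⟩

/-- The next length to be tested: the range is doubled until it contains a failing window, and
halved from then on. -/
def nextLength (lo hi : ℕ) : ℕ := min (lo + lo + 1) ((lo + hi) / 2)

/-- Bound on the number of tests left: `⌈log₂ (hi - lo)⌉` halvings and, below `2 ^ e`,
`e - ⌊log₂ (lo + 1)⌋` doublings. -/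
def searchSteps (e lo hi : ℕ) : ℕ := Nat.clog 2 (hi - lo) + (e - Nat.log 2 (lo + 1))

section Search

variable {e N lo hi : ℕ}

theorem lt_nextLength (h : lo + 1 < hi) : lo < nextLength lo hi := by
  unfold nextLength; omega

theorem nextLength_lt (h : lo < hi) : nextLength lo hi < hi := by
  unfold nextLength; omega

theorem clog_lt_of_two_mul_le {a b : ℕ} (hb : 2 ≤ b) (h : 2 * a ≤ b + 1) :
    Nat.clog 2 a < Nat.clog 2 b := by
  rw [Nat.clog_of_two_le one_lt_two hb]
  exact Nat.lt_succ_of_le (Nat.clog_mono_right 2 (by omega))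

theorem searchSteps_left_lt (h : lo + 1 < hi) :
    searchSteps e lo (nextLength lo hi) < searchSteps e lo hi :=
  Nat.add_lt_add_right (clog_lt_of_two_mul_le (by omega) (by unfold nextLength; omega)) _

theorem searchSteps_right_lt (h : lo + 1 < hi) (hhi : hi ≤ 2 ^ e) :
    searchSteps e (nextLength lo hi) hi < searchSteps e lo hi := by
  have hlt := lt_nextLength h
  rcases min_choice (lo + lo + 1) ((lo + hi) / 2) with hmin | hmin
  · have hdouble : nextLength lo hi + 1 = (lo + 1) * 2 := by
      rw [nextLength, hmin]; omega
    have hlog : Nat.log 2 (lo + 1) < e := Nat.log_lt_of_lt_pow (Nat.succ_ne_zero _) (by omega)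
    have hclog := Nat.clog_mono_right 2 (show hi - nextLength lo hi ≤ hi - lo by omega)
    have hlog' : Nat.log 2 (nextLength lo hi + 1) = Nat.log 2 (lo + 1) + 1 := by
      rw [hdouble, Nat.log_mul_base one_lt_two (Nat.succ_ne_zero _)]
    unfold searchSteps
    omega
  · have hclog := clog_lt_of_two_mul_le (a := hi - nextLength lo hi) (b := hi - lo) (by omega)
      (by rw [nextLength, hmin]; omega)
    have hlog := Nat.log_mono_right (b := 2) (show lo + 1 ≤ nextLength lo hi + 1 by omega)
    unfold searchSteps
    omega

theorem searchSteps_zero_le (hhi : hi ≤ 2 ^ e) : searchSteps e 0 hi ≤ 2 * e := by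
  have := Nat.clog_le_of_le_pow hhi
  simp only [searchSteps, zero_add, Nat.log_one_right, Nat.sub_zero]
  omega

end Search

/-- Positions in a window of length `l` at which `f` read from `p` differs from `g` read
from `z`. -/
def mismatches (f g : ℕ → ℕ) (p z l : ℕ) : Finset ℕ :=
  {x ∈ Finset.range l | f (p + x) ≠ g (z + x)}

theorem card_mismatches_succ (f g : ℕ → ℕ) (p z l : ℕ) :
    (mismatches f g p z (l + 1)).card =
      (mismatches f g p z l).card + if f (p + l) = g (z + l) then 0 else 1 := by
  rw [mismatches, Finset.range_add_one, Finset.filter_insert, ite_not]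
  split
  · rfl
  · rw [Finset.card_insert_of_notMem (by simp)]
    rfl

/-- The samples `R` reveal every diagonal with more than `k` mismatches in a window. -/
def RevealsMismatches (f g : ℕ → ℕ) (n k r L : ℕ) (R : ℕ → ℕ) : Prop :=
  ∀ i ≤ n, ∀ l, 0 < l → l ≤ n → ∀ b < r, ∀ y ≤ 2 * k + r,
    k < (mismatches f (shiftBy k g) (i + b) (i + y) l).card →
      ∃ j < numSamples k L l, R j % l ∈ mismatches f (shiftBy k g) (i + b) (i + y) l

theorem passes_of_match {f g R : ℕ → ℕ} {k r L i l D : ℕ} (hr : 0 < r) (hl : 0 < l)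
    (hD : D ≤ 2 * k) (h : ∀ p, i ≤ p → p < i + l + r → f p = shiftBy k g (p + D)) :
    Passes f g k r L R i l := by
  have hdiv := Nat.div_add_mod' (D + r - 1) r
  have hlt := Nat.mod_lt (D + r - 1) hr
  set a := (D + r - 1) / r
  refine ⟨a * r - D, by omega, a, by omega, fun j _ => ?_⟩
  have hj := Nat.mod_lt (R j) hl
  rw [sampled, h _ (by omega) (by omega)]
  exact congrArg (shiftBy k g) (by omega)

section Rounds

open WordRAM

variable {n σ : ℕ} {A B : Fin n → Fin σ} {k r L : ℕ} {R : ℕ → ℕ}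

theorem exists_edit_of_not_passes {i j l : ℕ} (hr : 0 < r) (hl : 0 < l) (hn : i + l + r ≤ n)
    (hij : i ≤ j + k) (hji : j ≤ i + k)
    (hfail : ¬Passes (readString A) (readString B) k r L R i l) :
    ∃ j' q, 0 < q ∧ j' ≤ j + (l + r) + q ∧ j + (l + r) ≤ j' + q ∧
      q + editDist ((List.ofFn A).drop (i + (l + r))) ((List.ofFn B).drop j') ≤
        editDist ((List.ofFn A).drop i) ((List.ofFn B).drop j) := by
  obtain ⟨s, hs, q, hq, hst, hts, htake⟩ := exists_add_editDist_drop_le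
    ((List.ofFn A).drop i) ((List.ofFn B).drop j) (t := l + r)
    (by rw [List.length_drop, List.length_ofFn]; omega)
  rw [List.drop_drop, List.drop_drop] at hq
  refine ⟨j + s, q, Nat.pos_of_ne_zero fun hq0 => hfail ?_, by omega, by omega, hq⟩
  obtain rfl : s = l + r := by omega
  refine passes_of_match hr hl (show j + k - i ≤ 2 * k by omega) fun p hip hpl => ?_
  have hget := congrArg (·[p - i]?) (htake hq0)
  rw [List.getElem?_take_of_lt (by omega), List.getElem?_take_of_lt (by omega),
    List.getElem?_drop, List.getElem?_drop] at hget
  rw [shiftBy, if_pos (by omega), readString_eq_iff,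
    show p + (j + k - i) - k = j + (p - i) by omega, ← hget, Nat.add_sub_cancel' hip]

theorem Rounds.le_ED {g i : ℕ} (hr : 0 < r) (hk : ED A B ≤ k)
    (h : Rounds (Passes (readString A) (readString B) k r L R) n r g i) (hi : i ≤ n) :
    g ≤ ED A B := by
  -- An optimal alignment of the suffixes at `i` and `j` extends to one of `A` and `B` with
  -- at least `g` edits in front.
  suffices hsuffix : ∃ j d, d = editDist ((List.ofFn A).drop i) ((List.ofFn B).drop j) ∧
      d + g ≤ ED A B ∧ d + i ≤ j + ED A B ∧ d + j ≤ i + ED A B by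
    obtain ⟨_, _, -, hg, -⟩ := hsuffix
    omega
  induction h with
  | zero => exact ⟨0, ED A B, rfl, le_rfl, by omega, by omega⟩
  | @succ g i l _ _ hround ih =>
    obtain ⟨j, d, rfl, hg, hij, hji⟩ := ih (by omega)
    obtain ⟨j', q, hq, hj', hj, hle⟩ :=
      exists_edit_of_not_passes (j := j) hr l.succ_pos (by omega) (by omega) (by omega)
        (hround.2 hi)
    rw [show i + (l + 1 + r) = i + l + 1 + r by omega] at hle
    exact ⟨j', _, rfl, by omega, by omega, by omega⟩

theorem editDist_drop_le_succ_succ (A B : Fin n → Fin σ) (k p z : ℕ) :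
    editDist ((List.ofFn A).drop p) ((List.ofFn B).drop (z - k)) ≤
      editDist ((List.ofFn A).drop (p + 1)) ((List.ofFn B).drop (z + 1 - k)) +
        if readString A p = shiftBy k (readString B) z then 0 else 1 := by
  rcases lt_or_ge z k with hz | hz
  · rw [shiftBy, if_neg (not_le.2 hz), show z + 1 - k = z - k by omega, ← List.tail_drop]
    split_ifs with h
    · rw [List.drop_eq_nil_of_le (by simpa using readString_eq_zero_iff.1 h)]
      exact le_rfl
    · exact editDist_le_tail_left _ _
  · have h := editDist_le_tail_tail ((List.ofFn A).drop p) ((List.ofFn B).drop (z - k))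
    simp only [List.head?_drop, ← readString_eq_iff, List.tail_drop] at h
    rwa [shiftBy, if_pos hz, Nat.sub_add_comm hz]

theorem editDist_drop_le_add_card_mismatches (A B : Fin n → Fin σ) (k p z l : ℕ) :
    editDist ((List.ofFn A).drop p) ((List.ofFn B).drop (z - k)) ≤
      editDist ((List.ofFn A).drop (p + l)) ((List.ofFn B).drop (z + l - k)) +
        (mismatches (readString A) (shiftBy k (readString B)) p z l).card := by
  induction l with
  | zero => exact Nat.le_add_right _ _
  | succ l ih =>
    have h := editDist_drop_le_succ_succ A B k (p + l) (z + l)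
    rw [card_mismatches_succ, ← add_assoc p, ← add_assoc z]
    omega

theorem ED_le (A B : Fin n → Fin σ) : ED A B ≤ n := by
  have h := editDist_drop_le_add_card_mismatches A B 0 0 0 n
  have hcard : (mismatches (readString A) (shiftBy 0 (readString B)) 0 0 n).card ≤ n :=
    (Finset.card_filter_le _ _).trans (Finset.card_range n).le
  have hA : (List.ofFn A).drop (0 + n) = [] := List.drop_eq_nil_of_le (by simp)
  have hB : (List.ofFn B).drop (0 + n - 0) = [] := List.drop_eq_nil_of_le (by simp)
  rw [hA, hB, editDist_nil_left, List.length_nil, zero_add] at h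
  exact h.trans hcard

theorem card_mismatches_le_of_passes {i l : ℕ}
    (hR : RevealsMismatches (readString A) (readString B) n k r L R) (hl : 0 < l)
    (hn : i + l ≤ n) (h : Passes (readString A) (readString B) k r L R i l) :
    ∃ b < r, ∃ y ≤ 2 * k + r,
      (mismatches (readString A) (shiftBy k (readString B)) (i + b) (i + y) l).card ≤ k := by
  obtain ⟨b, hb, a, ha, hagree⟩ := h
  refine ⟨b, hb, a * r, ha, not_lt.1 fun hlt => ?_⟩
  obtain ⟨j, hj, hmem⟩ := hR i (by omega) l hl (by omega) b hb _ ha hlt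
  refine (Finset.mem_filter.1 hmem).2 ?_
  rw [add_right_comm i b, add_right_comm i (a * r)]
  exact hagree j hj

theorem editDist_drop_le_of_isRound {i l : ℕ}
    (hR : RevealsMismatches (readString A) (readString B) n k r L R)
    (h : IsRound (Passes (readString A) (readString B) k r L R) n r i l) :
    editDist ((List.ofFn A).drop i) ((List.ofFn B).drop i) ≤
      editDist ((List.ofFn A).drop (i + l + 1 + r)) ((List.ofFn B).drop (i + l + 1 + r)) +
        (3 * k + 3 * r + 2) := by
  rcases Nat.eq_zero_or_pos l with rfl | hl
  · have hA := editDist_drop_left (List.ofFn A) ((List.ofFn B).drop i) i (1 + r)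
    have hB := editDist_drop_right ((List.ofFn A).drop (i + (1 + r))) (List.ofFn B)
      (i := i) (j := i + (1 + r)) (d := 1 + r) (by omega) (by omega)
    rw [add_zero, add_assoc i 1 r]
    omega
  obtain ⟨hn, hpass⟩ := h.1.resolve_left hl.ne'
  obtain ⟨b, hb, y, hy, hcard⟩ := card_mismatches_le_of_passes hR hl (by omega) hpass
  calc editDist ((List.ofFn A).drop i) ((List.ofFn B).drop i)
    _ ≤ editDist ((List.ofFn A).drop (i + b)) ((List.ofFn B).drop i) + b :=
      editDist_drop_left _ _ _ _
    _ ≤ editDist ((List.ofFn A).drop (i + b)) ((List.ofFn B).drop (i + y - k)) + (k + r) + b :=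
      Nat.add_le_add_right (editDist_drop_right _ _ (by omega) (by omega)) _
    _ ≤ editDist ((List.ofFn A).drop (i + b + l)) ((List.ofFn B).drop (i + y + l - k)) + k +
          (k + r) + b := by
      have := editDist_drop_le_add_card_mismatches A B k (i + b) (i + y) l
      omega
    _ ≤ editDist ((List.ofFn A).drop (i + l + 1 + r)) ((List.ofFn B).drop (i + y + l - k)) +
          (1 + r - b) + k + (k + r) + b := by
      have := editDist_drop_left (List.ofFn A) ((List.ofFn B).drop (i + y + l - k)) (i + b + l)
        (1 + r - b)
      rw [show i + b + l + (1 + r - b) = i + l + 1 + r by omega] at this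
      omega
    _ ≤ editDist ((List.ofFn A).drop (i + l + 1 + r)) ((List.ofFn B).drop (i + l + 1 + r)) +
          (k + r + 1) + (1 + r - b) + k + (k + r) + b := by
      have := editDist_drop_right ((List.ofFn A).drop (i + l + 1 + r)) (List.ofFn B)
        (i := i + y + l - k) (j := i + l + 1 + r) (d := k + r + 1) (by omega) (by omega)
      omega
    _ ≤ _ := by omega

theorem Rounds.ED_le {g i : ℕ}
    (hR : RevealsMismatches (readString A) (readString B) n k r L R)
    (h : Rounds (Passes (readString A) (readString B) k r L R) n r g i) (hi : n < i) :
    ED A B ≤ g * (3 * k + 3 * r + 2) := by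
  suffices hsuffix : ED A B ≤
      editDist ((List.ofFn A).drop i) ((List.ofFn B).drop i) + g * (3 * k + 3 * r + 2) by
    rwa [List.drop_eq_nil_of_le (by simpa using hi.le),
      List.drop_eq_nil_of_le (by simpa using hi.le), editDist_nil_left, List.length_nil,
      zero_add] at hsuffix
  clear hi
  induction h with
  | zero => exact Nat.le_add_right _ _
  | succ _ _ hround ih =>
    have := editDist_drop_le_of_isRound hR hround
    rw [Nat.add_mul]
    omega

theorem IsGreedyAnswer.eq_small_or_large {P : ℕ → ℕ → Prop} {x : ℕ}
    (h : IsGreedyAnswer P n k r x) : x = SMALL ∨ x = LARGE := by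
  obtain ⟨_, _, -, h | h⟩ := h
  · exact .inl h.2.2
  · exact .inr h.2.2

theorem IsGreedyAnswer.eq_small {x : ℕ} (hr : 0 < r) (hk : ED A B ≤ k)
    (h : IsGreedyAnswer (Passes (readString A) (readString B) k r L R) n k r x) : x = SMALL := by
  obtain ⟨g, i, hrounds, ⟨-, -, hx⟩ | ⟨hi, hg, -⟩⟩ := h
  · exact hx
  · have := hrounds.le_ED hr hk hi
    omega

theorem IsGreedyAnswer.eq_large {x : ℕ}
    (hR : RevealsMismatches (readString A) (readString B) n k r L R)
    (hED : (k + 1) * (3 * k + 3 * r + 2) < ED A B)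
    (h : IsGreedyAnswer (Passes (readString A) (readString B) k r L R) n k r x) : x = LARGE := by
  obtain ⟨g, i, hrounds, ⟨hi, hg, -⟩ | ⟨-, -, hx⟩⟩ := h
  · exact absurd ((hrounds.ED_le hR hi).trans (Nat.mul_le_mul_right _ hg)) (not_le.2 hED)
  · exact hx

end Rounds

end GapED

namespace WordRAM

section Values

/-- The number of words of the machine. As `simp` does not unfold it, side conditions stay
linear inequalities. -/
def Env.size (E : Env) : ℕ := 2 ^ E.w

/-- Value of an expression computed without reduction modulo `2 ^ w`. -/
def Expr.value (E : Env) (s : State) : Expr → ℕ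
  | .lit c => c
  | .reg x => s.reg x
  | .bin o e₁ e₂ => o.apply (e₁.value E s) (e₂.value E s)
  | .load a e => s.arr a (e.value E s)
  | .charA e => E.strA (e.value E s)
  | .charB e => E.strB (e.value E s)

/-- No literal, operation or character occurring in the expression overflows a word, so that the
machine computes its `Expr.value`. -/
def Expr.Fits (E : Env) (s : State) : Expr → Prop
  | .lit c => c < E.size
  | .reg _ => True
  | .bin o e₁ e₂ => e₁.Fits E s ∧ e₂.Fits E s ∧ o.apply (e₁.value E s) (e₂.value E s) < E.size
  | .load _ e => e.Fits E s
  | .charA e => e.Fits E s ∧ E.strA (e.value E s) < E.size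
  | .charB e => e.Fits E s ∧ E.strB (e.value E s) < E.size

theorem Expr.eval_eq_value {E : Env} {s : State} {e : Expr} (h : e.Fits E s) :
    e.eval E s = e.value E s := by
  induction e with
  | lit c => exact Nat.mod_eq_of_lt h
  | reg x => rfl
  | bin o e₁ e₂ ih₁ ih₂ =>
    obtain ⟨h₁, h₂, hlt⟩ := h
    rw [Expr.eval, ih₁ h₁, ih₂ h₂]
    exact Nat.mod_eq_of_lt hlt
  | load a e ih => rw [Expr.eval, ih h, Expr.value]
  | charA e ih => rw [Expr.eval, ih h.1]; exact Nat.mod_eq_of_lt h.2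
  | charB e ih => rw [Expr.eval, ih h.1]; exact Nat.mod_eq_of_lt h.2

theorem Expr.fits_lt {E : Env} {s : State} {e e' : Expr} (he : e.Fits E s) (he' : e'.Fits E s)
    (hsize : 1 < E.size) : (Expr.bin .lt e e').Fits E s := by
  refine ⟨he, he', ?_⟩
  simp only [Op.apply]
  split <;> omega

theorem Expr.value_lt_ne_zero {E : Env} {s : State} {e e' : Expr} :
    (Expr.bin .lt e e').value E s ≠ 0 ↔ e.value E s < e'.value E s := by
  simp [Expr.value, Op.apply]

end Values

/-- What is fixed once the random words have been drawn: the input parameters, the size `s` of the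
alphabet (with the symbol for positions out of range), the width `r` of a baby step, the number `L`
of samples per `k` positions, the random words, and the position on the tape. -/
structure Params where
  n : ℕ := 0
  k : ℕ := 0
  s : ℕ := 0
  r : ℕ := 0
  L : ℕ := 0
  words : ℕ → ℕ := fun _ => 0
  pos : ℕ := 0

/-- State of the outer loop: the position reached in the first string and the number of rounds. -/
structure Progress extends Params where
  i : ℕ := 0
  g : ℕ := 0

/-- State of a round: the range of window lengths left to the search and the length under test. -/
structure Search extends Progress where
  lo : ℕ := 0
  hi : ℕ := 0
  mid : ℕ := 0

/-- State of the test of a window: the number `m` of samples, the root of the trie, the offset of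
the string being read, and the outcome. -/
structure Probe extends Search where
  m : ℕ := 0
  root : ℕ := 0
  offset : ℕ := 0
  ok : ℕ := 0

/-- Contents of the memory. The registers are grouped by the level of the program that writes to
them, so that what a subprogram preserves is a single equation between projections. -/
structure Store extends Probe where
  j : ℕ := 0
  node : ℕ := 0
  q : ℕ := 0
  ctr : ℕ := 0
  trie : ℕ → ℕ := fun _ => 0

/-- Names of the registers. -/
inductive Reg
  | n | k | s | r | L | i | g | lo | hi | mid | m | root | offset | ok | j | node | q | ctr

/-- The register of the machine with a given name; `n`, `k` and the alphabet size come first, as in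
`WordRAM.init`. -/
def Reg.index (x : Reg) : ℕ := x.ctorIdx

instance : Coe Reg Expr := ⟨fun x => .reg x.index⟩

namespace Store

/-- Contents of the registers, in the order of their indices. -/
def regs (v : Store) : List ℕ :=
  [v.n, v.k, v.s, v.r, v.L, v.i, v.g, v.lo, v.hi, v.mid, v.m, v.root, v.offset, v.ok, v.j, v.node,
    v.q, v.ctr]

/-- The state of the machine: array `0` is the trie and array `1` holds the random words. -/
def toState (v : Store) : State where
  reg x := v.regs.getD x 0
  arr a := if a = 0 then v.trie else if a = 1 then v.words else fun _ => 0
  pos := v.pos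

/-- The value of a named register. -/
def get (v : Store) : Reg → ℕ
  | .n => v.n | .k => v.k | .s => v.s | .r => v.r | .L => v.L | .i => v.i | .g => v.g
  | .lo => v.lo | .hi => v.hi | .mid => v.mid | .m => v.m | .root => v.root
  | .offset => v.offset | .ok => v.ok | .j => v.j | .node => v.node | .q => v.q | .ctr => v.ctr

/-- The store after writing to a named register. -/
def set (v : Store) (x : Reg) (a : ℕ) : Store :=
  match x with
  | .n => { v with n := a } | .k => { v with k := a } | .s => { v with s := a }
  | .r => { v with r := a } | .L => { v with L := a } | .i => { v with i := a }
  | .g => { v with g := a } | .lo => { v with lo := a } | .hi => { v with hi := a }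
  | .mid => { v with mid := a } | .m => { v with m := a } | .root => { v with root := a }
  | .offset => { v with offset := a } | .ok => { v with ok := a } | .j => { v with j := a }
  | .node => { v with node := a } | .q => { v with q := a } | .ctr => { v with ctr := a }

theorem toState_reg (v : Store) (x : Reg) : v.toState.reg x.index = v.get x := by
  cases x <;> rfl

theorem toState_trie (v : Store) : v.toState.arr 0 = v.trie := rfl

theorem toState_words (v : Store) : v.toState.arr 1 = v.words := rfl

theorem toState_setReg (v : Store) (x : Reg) (a : ℕ) :
    v.toState.setReg x.index a = (v.set x a).toState := by
  have hset : (v.set x a).regs = v.regs.set x.index a := by cases x <;> rfl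
  have hlt : x.index < v.regs.length := by change x.index < 18; cases x <;> decide
  have harr : (v.set x a).toState.arr = v.toState.arr := by cases x <;> rfl
  have hpos : (v.set x a).toState.pos = v.toState.pos := by cases x <;> rfl
  have hreg : (v.set x a).toState.reg = Function.update v.toState.reg x.index a := by
    funext y
    by_cases hy : y = x.index
    · simp [toState, hset, hy, hlt]
    · simp [toState, hset, hy, Ne.symm hy]
  simp only [State.setReg, ← hreg, ← harr, ← hpos]

theorem toState_setArr_trie (v : Store) (i a : ℕ) :
    v.toState.setArr 0 i a = { v with trie := Function.update v.trie i a }.toState := by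
  refine congrArg (fun f => State.mk _ f _) (funext fun y => ?_)
  by_cases hy : y = 0
  · simp [toState, hy]
  · simp [toState, hy]

theorem toState_setArr_words (v : Store) (i a : ℕ) :
    v.toState.setArr 1 i a = { v with words := Function.update v.words i a }.toState := by
  refine congrArg (fun f => State.mk _ f _) (funext fun y => ?_)
  by_cases hy : y = 1
  · simp [toState, hy]
  · simp [toState, hy]

end Store

/-- `P` halts when started in the store `v`, and its running time and final store satisfy `Q`. -/
def Runs (E : Env) (P : Prog) (v : Store) (Q : ℕ → Store → Prop) : Prop :=
  ∃ t v', Exec E P v.toState t v'.toState ∧ Q t v'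

namespace Runs

variable {E : Env} {P P' : Prog} {v : Store} {Q : ℕ → Store → Prop} {e e' : Expr} {x : Reg}

theorem mono {Q' : ℕ → Store → Prop} (h : Runs E P v Q) (hQ : ∀ t v', Q t v' → Q' t v') :
    Runs E P v Q' := by
  obtain ⟨t, v', hexec, hq⟩ := h
  exact ⟨t, v', hexec, hQ t v' hq⟩

theorem skip (h : Q 1 v) : Runs E .skip v Q := ⟨1, v, .skip _, h⟩

theorem seq (h : Runs E P v fun t₁ v₁ => Runs E P' v₁ fun t₂ v₂ => Q (t₁ + t₂) v₂) :
    Runs E (.seq P P') v Q := by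
  obtain ⟨t₁, v₁, hexec₁, t₂, v₂, hexec₂, hq⟩ := h
  exact ⟨_, v₂, .seq hexec₁ hexec₂, hq⟩

theorem assign (h : Q (e.cost + 1) (v.set x (e.value E v.toState)))
    (fits : e.Fits E v.toState := by
      simp only [Expr.Fits, Expr.value, Op.apply, Store.toState_reg, Store.toState_words,
        Store.toState_trie, Store.get, Store.set, and_true, true_and] <;>
      omega) :
    Runs E (.assign x.index e) v Q :=
  ⟨_, _, by rw [← Store.toState_setReg, ← Expr.eval_eq_value fits]; exact .assign _ _ _, h⟩

theorem store_trie
    (h : Q (e.cost + e'.cost + 1)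
      { v with trie := Function.update v.trie (e.value E v.toState) (e'.value E v.toState) })
    (fits : e.Fits E v.toState ∧ e'.Fits E v.toState := by
      simp only [Expr.Fits, Expr.value, Op.apply, Store.toState_reg, Store.toState_words,
        Store.toState_trie, Store.get, Store.set, and_true, true_and] <;>
      omega) :
    Runs E (.store 0 e e') v Q := by
  refine ⟨_, _, ?_, h⟩
  rw [← Store.toState_setArr_trie, ← Expr.eval_eq_value fits.1, ← Expr.eval_eq_value fits.2]
  exact .store _ _ _ _

theorem store_words
    (h : Q (e.cost + e'.cost + 1)
      { v with words := Function.update v.words (e.value E v.toState) (e'.value E v.toState) })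
    (fits : e.Fits E v.toState ∧ e'.Fits E v.toState) :
    Runs E (.store 1 e e') v Q := by
  refine ⟨_, _, ?_, h⟩
  rw [← Store.toState_setArr_words, ← Expr.eval_eq_value fits.1, ← Expr.eval_eq_value fits.2]
  exact .store _ _ _ _

theorem rand (h : Q 1 { v.set x (E.tape v.pos) with pos := v.pos + 1 }) :
    Runs E (.rand x.index) v Q := by
  refine ⟨1, _, ?_, h⟩
  have hexec := Exec.rand (E := E) v.toState x.index
  rw [Store.toState_setReg] at hexec
  exact hexec

theorem ite
    (htrue : e.value E v.toState ≠ 0 → Runs E P v fun t v' => Q (e.cost + 1 + t) v')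
    (hfalse : e.value E v.toState = 0 → Runs E P' v fun t v' => Q (e.cost + 1 + t) v')
    (fits : e.Fits E v.toState := by
      simp only [Expr.Fits, Expr.value, Op.apply, Store.toState_reg, Store.toState_words,
        Store.toState_trie, Store.get, Store.set, and_true, true_and] <;>
      omega) :
    Runs E (.ite e P P') v Q := by
  rw [← Expr.eval_eq_value fits] at htrue hfalse
  by_cases h : e.eval E v.toState = 0
  · obtain ⟨t, v', hexec, hq⟩ := hfalse h
    exact ⟨_, v', .iteFalse h hexec, hq⟩
  · obtain ⟨t, v', hexec, hq⟩ := htrue h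
    exact ⟨_, v', .iteTrue h hexec, hq⟩

/-- A loop with an invariant `I τ μ v` about the time `τ` elapsed so far and a decreasing
measure `μ`. -/
theorem while_elapsed (I : ℕ → ℕ → Store → Prop) {μ : ℕ} (hinit : I 0 μ v)
    (hfits : ∀ τ μ v, I τ μ v → e.Fits E v.toState)
    (hstep : ∀ τ μ v, I τ μ v → e.value E v.toState ≠ 0 →
      Runs E P v fun t v' => ∃ μ' < μ, I (τ + (e.cost + 1 + t)) μ' v')
    (hend : ∀ τ μ v', I τ μ v' → e.value E v'.toState = 0 → Q (τ + (e.cost + 1)) v') :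
    Runs E (.while e P) v Q := by
  suffices h : ∀ τ, I τ μ v → ∃ t v', Exec E (.while e P) v.toState t v'.toState ∧ Q (τ + t) v' by
    simpa only [Runs, zero_add] using h 0 hinit
  clear hinit
  induction μ using Nat.strong_induction_on generalizing v with
  | _ μ ih =>
    intro τ hI
    have hvalue := Expr.eval_eq_value (hfits τ μ v hI)
    by_cases h : e.value E v.toState = 0
    · exact ⟨_, v, .whileFalse (hvalue.trans h), hend τ μ v hI h⟩
    · obtain ⟨t, v₁, hexec, μ', hlt, hI'⟩ := hstep τ μ v hI h
      obtain ⟨t', v', hexec', hq⟩ := ih μ' hlt _ hI'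
      exact ⟨_, v', .whileTrue (hvalue ▸ h) hexec hexec', by rwa [← add_assoc]⟩

theorem while_iterate (I : ℕ → Store → Prop) {N c : ℕ} (hinit : I 0 v)
    (hcond : ∀ j v, I j v → e.Fits E v.toState ∧ (e.value E v.toState ≠ 0 ↔ j < N))
    (hstep : ∀ j v, I j v → j < N →
      Runs E P v fun t v' => I (j + 1) v' ∧ e.cost + 1 + t ≤ c)
    (hend : ∀ t v', I N v' → t ≤ N * c + e.cost + 1 → Q t v') :
    Runs E (.while e P) v Q := by
  refine while_elapsed (fun τ μ v => ∃ j ≤ N, I j v ∧ τ ≤ j * c ∧ μ = N - j) (μ := N)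
    ⟨0, N.zero_le, hinit, Nat.zero_le _, rfl⟩ (fun _ _ v ⟨j, _, hI, _⟩ => (hcond j v hI).1) ?_ ?_
  · rintro τ _ v ⟨j, -, hI, hτ, rfl⟩ hne
    have hj : j < N := (hcond j v hI).2.1 hne
    refine (hstep j v hI hj).mono fun t v' ⟨hI', _⟩ =>
      ⟨N - (j + 1), by omega, j + 1, hj, hI', ?_, rfl⟩
    rw [Nat.add_mul]
    omega
  · rintro τ _ v' ⟨j, hj, hI, hτ, -⟩ hzero
    obtain rfl : j = N := le_antisymm hj (not_lt.1 fun h => (hcond j v' hI).2.2 h hzero)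
    exact hend _ v' hI (by omega)

end Runs

/-- The node reached from the node `u` along a word, when the children of `u` are stored in `T` at
the addresses `u * s, …, u * s + s - 1`; the node `0` stands for a missing child. -/
def walk (T : ℕ → ℕ) (s u : ℕ) (l : List ℕ) : ℕ := l.foldl (fun u c => T (u * s + c)) u

section Trie

variable {T : ℕ → ℕ} {s root ctr c : ℕ} {W : Set (List ℕ)} {l : List ℕ}

theorem walk_concat (T : ℕ → ℕ) (s u : ℕ) (l : List ℕ) (c : ℕ) :
    walk T s u (l ++ [c]) = T (walk T s u l * s + c) := by
  simp [walk]

/-- The nodes above `ctr` are unused, and the node `0` has no children. -/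
structure Blank (T : ℕ → ℕ) (s ctr : ℕ) : Prop where
  dead : ∀ a < s, T a = 0
  fresh : ∀ a, (ctr + 1) * s ≤ a → T a = 0

theorem Blank.mono {ctr' : ℕ} (h : Blank T s ctr) (hle : ctr ≤ ctr') : Blank T s ctr' :=
  ⟨h.dead, fun a ha => h.fresh a (le_trans (by gcongr) ha)⟩

theorem Blank.child_eq_zero (h : Blank T s ctr) {u : ℕ} (hc : c < s) (hu : u = 0 ∨ ctr < u) :
    T (u * s + c) = 0 := by
  rcases hu with rfl | hu
  · exact h.dead _ (by omega)
  · exact h.fresh _ (Nat.le_add_right_of_le (Nat.mul_le_mul_right s hu))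

/-- The nodes between `root` and `ctr` form a trie, and the words over `{0, …, s - 1}` that can be
read in it are those of `W`. -/
structure IsTrie (T : ℕ → ℕ) (s root ctr : ℕ) (W : Set (List ℕ)) : Prop extends
    Blank T s ctr where
  root_pos : 0 < root
  walk_le : ∀ l, (∀ c ∈ l, c < s) → walk T s root l ≤ ctr
  walk_inj : ∀ l l', (∀ c ∈ l, c < s) → (∀ c ∈ l', c < s) → walk T s root l ≠ 0 →
    walk T s root l = walk T s root l' → l = l'
  walk_ne_zero_iff : ∀ l, (∀ c ∈ l, c < s) → (walk T s root l ≠ 0 ↔ l ∈ W)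

theorem IsTrie.nil_mem (h : IsTrie T s root ctr W) : [] ∈ W :=
  (h.walk_ne_zero_iff [] (by simp)).1 h.root_pos.ne'

theorem Blank.isTrie_singleton (h : Blank T s ctr) : IsTrie T s (ctr + 1) (ctr + 1) {[]} := by
  have hwalk : ∀ l, (∀ c ∈ l, c < s) → walk T s (ctr + 1) l = if l = [] then ctr + 1 else 0 := by
    intro l hl
    induction l using List.reverseRecOn with
    | nil => rfl
    | append_singleton l c ih =>
      rw [List.forall_mem_append, List.forall_mem_singleton] at hl
      rw [walk_concat, ih hl.1, if_neg (List.append_ne_nil_of_right_ne_nil _ (by simp))]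
      exact h.child_eq_zero hl.2 (by split <;> simp)
  refine ⟨h.mono (Nat.le_succ ctr), ctr.succ_pos, fun l hl => ?_, fun l l' hl hl' h0 heq => ?_,
    fun l hl => ?_⟩
  · rw [hwalk l hl]; split <;> omega
  · rw [hwalk l hl] at h0 heq
    rw [hwalk l' hl'] at heq
    split_ifs at h0 heq <;> simp_all
  · rw [hwalk l hl]; split <;> simp_all

theorem mul_add_inj_of_lt {u u' c' : ℕ} (hc : c < s) (hc' : c' < s)
    (h : u * s + c = u' * s + c') : u = u' ∧ c = c' := by
  have hs : 0 < s := by omega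
  have hdiv := congrArg (· / s) h
  have hmod := congrArg (· % s) h
  simp only [Nat.mul_add_mod_self_right, Nat.mod_eq_of_lt, hc, hc'] at hmod
  simp only [mul_comm _ s, Nat.mul_add_div hs, Nat.div_eq_of_lt, hc, hc', add_zero] at hdiv
  exact ⟨hdiv, hmod⟩

theorem IsTrie.walk_update (h : IsTrie T s root ctr W) (hl : ∀ c ∈ l, c < s) (hc : c < s)
    (hne : walk T s root l ≠ 0) (hnew : walk T s root (l ++ [c]) = 0) {l' : List ℕ}
    (hl' : ∀ c ∈ l', c < s) :
    walk (Function.update T (walk T s root l * s + c) (ctr + 1)) s root l' =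
      if l' = l ++ [c] then ctr + 1 else walk T s root l' := by
  induction l' using List.reverseRecOn with
  | nil => simp [walk]
  | append_singleton l₁ d ih =>
    rw [List.forall_mem_append, List.forall_mem_singleton] at hl'
    obtain ⟨hl₁, hd⟩ := hl'
    rw [walk_concat, walk_concat, ih hl₁]
    split_ifs with h₁ h₂ h₂
    · simp [h₁] at h₂
    · have haddr : (ctr + 1) * s + d ≠ walk T s root l * s + c := fun heq => by
        have := h.walk_le l hl
        have := (mul_add_inj_of_lt hd hc heq).1
        omega
      rw [Function.update_of_ne haddr, h.child_eq_zero hd (.inr ctr.lt_succ_self), h₁, hnew,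
        h.child_eq_zero hd (.inl rfl)]
    · obtain ⟨rfl, rfl⟩ : l₁ = l ∧ d = c := by simpa using h₂
      exact Function.update_self ..
    · refine Function.update_of_ne (fun haddr => h₂ ?_) _ _
      obtain ⟨heq, rfl⟩ := mul_add_inj_of_lt hd hc haddr
      rw [h.walk_inj l l₁ hl hl₁ hne heq.symm]

theorem IsTrie.insert (h : IsTrie T s root ctr W) (hl : ∀ c ∈ l, c < s) (hc : c < s)
    (hne : walk T s root l ≠ 0) (hnew : walk T s root (l ++ [c]) = 0) :
    IsTrie (Function.update T (walk T s root l * s + c) (ctr + 1)) s root (ctr + 1)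
      (insert (l ++ [c]) W) := by
  have hwalk := fun l' => h.walk_update hl hc hne hnew (l' := l')
  have hle := h.walk_le l hl
  refine ⟨⟨fun a ha => ?_, fun a ha => ?_⟩, h.root_pos, fun l' hl' => ?_,
    fun l₁ l₂ hl₁ hl₂ h0 heq => ?_, fun l' hl' => ?_⟩
  · have : s ≤ walk T s root l * s := Nat.le_mul_of_pos_left s (Nat.pos_of_ne_zero hne)
    rw [Function.update_of_ne (by omega), h.dead a ha]
  · have := Nat.mul_le_mul_right s hle
    rw [Nat.add_mul, one_mul, Nat.add_mul, one_mul] at ha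
    rw [Function.update_of_ne (by omega), h.fresh a (by rw [Nat.add_mul]; omega)]
  · rw [hwalk l' hl']
    have := h.walk_le l' hl'
    split <;> omega
  · rw [hwalk l₁ hl₁] at h0 heq
    rw [hwalk l₂ hl₂] at heq
    have := h.walk_le l₁ hl₁
    have := h.walk_le l₂ hl₂
    split_ifs at h0 heq with h₁ h₂ h₂
    · rw [h₁, h₂]
    · omega
    · omega
    · exact h.walk_inj l₁ l₂ hl₁ hl₂ h0 heq
  · rw [hwalk l' hl', Set.mem_insert_iff, ← h.walk_ne_zero_iff l' hl']
    split_ifs with h₁ <;> simp [h₁]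

end Trie

/-- The values `f 0, …, f (j - 1)`. -/
def firstValues (f : ℕ → ℕ) (j : ℕ) : List ℕ := (List.range j).map f

theorem firstValues_succ (f : ℕ → ℕ) (j : ℕ) :
    firstValues f (j + 1) = firstValues f j ++ [f j] := by
  simp [firstValues, List.range_succ]

theorem image_firstValues_Iic_succ (f : ℕ → ℕ) (j : ℕ) :
    firstValues f '' Set.Iic (j + 1) =
      insert (firstValues f j ++ [f j]) (firstValues f '' Set.Iic j) := by
  rw [← firstValues_succ, ← Set.image_insert_eq]
  congr 1
  ext x
  simp [Nat.le_succ_iff_eq_or_le]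

theorem forall_mem_firstValues {f : ℕ → ℕ} {s : ℕ} (hf : ∀ j, f j < s) (j : ℕ) :
    ∀ c ∈ firstValues f j, c < s := by
  simp only [firstValues, List.forall_mem_map]
  exact fun a _ => hf a

theorem firstValues_eq_iff {f g : ℕ → ℕ} {j j' : ℕ} :
    firstValues f j = firstValues g j' ↔ j = j' ∧ ∀ x < j, f x = g x := by
  constructor
  · intro h
    obtain rfl : j = j' := by simpa [firstValues] using congrArg List.length h
    exact ⟨rfl, by simpa [firstValues] using h⟩
  · rintro ⟨rfl, h⟩
    simpa [firstValues] using h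

local notation:65 e₁:65 " +ₑ " e₂:66 => Expr.bin Op.add e₁ e₂
local notation:65 e₁:65 " -ₑ " e₂:66 => Expr.bin Op.sub e₁ e₂
local notation:70 e₁:70 " *ₑ " e₂:71 => Expr.bin Op.mul e₁ e₂
local notation:70 e₁:70 " /ₑ " e₂:71 => Expr.bin Op.div e₁ e₂
local notation:70 e₁:70 " %ₑ " e₂:71 => Expr.bin Op.mod e₁ e₂
local notation:50 e₁:51 " <ₑ " e₂:51 => Expr.bin Op.lt e₁ e₂
local notation:40 x:41 " ::= " e:41 => Prog.assign (Reg.index x) e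
local notation:30 P:31 " ;; " P':30 => Prog.seq P P'

open GapED WordRAM.Expr WordRAM.Prog WordRAM.Reg

/-- Give the node `node` a child for the next sampled character of the first string, unless it has
one; `q` becomes the address of that child. -/
def makeChild : Prog :=
  q ::= node *ₑ s +ₑ charA (i +ₑ load 1 j %ₑ mid +ₑ offset) ;;
  ite (load 0 q) skip (ctr ::= ctr +ₑ lit 1 ;; store 0 q ctr)

/-- Insert the sampled characters of the first string at a given offset into the trie. -/
def insertWord : Prog :=
  node ::= root ;;
  j ::= lit 0 ;;
  .while (j <ₑ m) (makeChild ;; node ::= load 0 q ;; j ::= j +ₑ lit 1)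

/-- Move to the child of `node` for the next sampled character of the shifted second string. -/
def followChild : Prog :=
  q ::= i +ₑ load 1 j %ₑ mid +ₑ offset ;;
  node ::= load 0 (node *ₑ s +ₑ (k <ₑ q +ₑ lit 1) *ₑ charB (q -ₑ k))

/-- Walk along the sampled characters of the shifted second string at a given offset. -/
def lookupWord : Prog :=
  node ::= root ;;
  j ::= lit 0 ;;
  .while (j <ₑ m) (followChild ;; j ::= j +ₑ lit 1)

variable {E : Env} {v : Store} {W : Set (List ℕ)}

theorem runs_makeChild (hA : ∀ x, E.strA x < v.s) (hmid : 0 < v.mid)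
    (hpos : v.i + v.mid + v.offset < E.size) (hctr : (v.ctr + 1) * v.s < E.size)
    (hT : IsTrie v.trie v.s v.root v.ctr W) {l : List ℕ} (hl : ∀ c ∈ l, c < v.s)
    (hnode : v.node = walk v.trie v.s v.root l) (hne : v.node ≠ 0) {c : ℕ}
    (hc : c = sampled E.strA v.words v.i v.mid v.offset v.j) :
    Runs E makeChild v fun t v' => t ≤ 24 ∧ v'.toProbe = v.toProbe ∧ v'.j = v.j ∧
      v'.ctr ≤ v.ctr + 1 ∧ IsTrie v'.trie v.s v.root v'.ctr (insert (l ++ [c]) W) ∧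
      v'.trie v'.q = walk v'.trie v.s v.root (l ++ [c]) := by
  have hcs : c < v.s := hc ▸ hA _
  have hlc : ∀ d ∈ l ++ [c], d < v.s := by simpa [or_imp, forall_and] using ⟨hl, hcs⟩
  have hmod := Nat.mod_lt (v.words v.j) hmid
  have haddr : v.node * v.s + c < E.size := by
    have := Nat.mul_le_mul_right v.s (hnode.trans_le (hT.walk_le l hl))
    rw [Nat.add_mul] at hctr
    omega
  have hctr' : v.ctr + 1 < E.size :=
    (Nat.le_mul_of_pos_right _ (by omega : 0 < v.s)).trans_lt hctr
  have hchild : walk v.trie v.s v.root (l ++ [c]) = v.trie (v.node * v.s + c) := by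
    rw [walk_concat, hnode]
  rw [sampled] at hc
  subst hc
  refine .seq (.assign (.ite (fun h => .skip ?_) fun h => .seq (.assign (.store_trie ?_))))
  · refine ⟨by simp [Expr.cost], rfl, rfl, Nat.le_succ _, ?_, hchild.symm⟩
    rwa [Set.insert_eq_of_mem ((hT.walk_ne_zero_iff _ hlc).1 (hchild.trans_ne h))]
  · have hins := hT.insert hl hcs (hnode ▸ hne) (hchild.trans h)
    rw [← hnode] at hins
    refine ⟨by simp [Expr.cost], rfl, rfl, le_rfl, hins, ?_⟩
    have hwalk := hT.walk_update hl hcs (hnode ▸ hne) (hchild.trans h) hlc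
    rw [← hnode, if_pos rfl] at hwalk
    exact (Function.update_self ..).trans hwalk.symm

theorem runs_insertWord (hA : ∀ x, E.strA x < v.s) (hmid : 0 < v.mid)
    (hpos : v.i + v.mid + v.offset < E.size) (hctr : (v.ctr + v.m + 1) * v.s < E.size)
    (hT : IsTrie v.trie v.s v.root v.ctr W) :
    Runs E insertWord v fun t v' => t ≤ 50 * v.m + 20 ∧ v'.toProbe = v.toProbe ∧
      v'.ctr ≤ v.ctr + v.m ∧ IsTrie v'.trie v.s v.root v'.ctr
        (W ∪ firstValues (sampled E.strA v.words v.i v.mid v.offset) '' Set.Iic v.m) := by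
  set f := sampled E.strA v.words v.i v.mid v.offset
  have hfs : ∀ j, f j < v.s := fun j => hA _
  have hsize : v.ctr + v.m + 1 < E.size :=
    (Nat.le_mul_of_pos_right _ ((Nat.zero_le _).trans_lt (hA 0))).trans_lt hctr
  refine .seq (.assign (.seq (.assign (.while_iterate (N := v.m) (c := 50)
    (fun j u => u.toProbe = v.toProbe ∧ u.j = j ∧ u.ctr ≤ v.ctr + j ∧
      IsTrie u.trie v.s v.root u.ctr (W ∪ firstValues f '' Set.Iic j) ∧
      u.node = walk u.trie v.s v.root (firstValues f j)) ?_ ?_ ?_ ?_))))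
  · refine ⟨rfl, rfl, le_rfl, ?_, rfl⟩
    rwa [show Set.Iic 0 = {0} from Set.Iic_bot, Set.image_singleton, firstValues, List.range_zero,
      List.map_nil, Set.union_eq_self_of_subset_right (Set.singleton_subset_iff.2 hT.nil_mem)]
  · rintro j u ⟨hu, rfl, -⟩
    rw [value_lt_ne_zero, ← congrArg Probe.m hu]
    exact ⟨fits_lt trivial trivial (by omega), Iff.rfl⟩
  · rintro j u ⟨hu, rfl, hctru, htrie, hnode⟩ hj
    have hctr' : (u.ctr + 1) * v.s < E.size := (Nat.mul_le_mul_right _ (by omega)).trans_lt hctr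
    have hmem := (htrie.walk_ne_zero_iff _ (forall_mem_firstValues hfs _)).2
      (.inr ⟨u.j, Set.self_mem_Iic, rfl⟩)
    have hrun := runs_makeChild (E := E) (v := u) (c := f u.j) (l := firstValues f u.j)
      (W := W ∪ firstValues f '' Set.Iic u.j)
    rw [hu] at hrun
    refine .seq ((hrun hA hmid hpos hctr' htrie (forall_mem_firstValues hfs _) hnode
      (hnode ▸ hmem) rfl).mono ?_)
    rintro t u' ⟨ht, hu', hj', hctr'', htrie', hq⟩
    refine .seq (.assign (.assign
      ⟨⟨hu', congrArg (· + 1) hj', hctr''.trans (by omega), ?_, ?_⟩, ?_⟩))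
    · rw [image_firstValues_Iic_succ, Set.union_insert]
      exact htrie'
    · rw [firstValues_succ]; exact hq
    · simp only [Expr.cost]; omega
  · rintro t u ⟨hu, -, hctru, htrie, -⟩ ht
    refine ⟨?_, hu, hctru, htrie⟩
    simp only [Expr.cost] at ht ⊢
    omega

theorem runs_followChild (hB : ∀ x, E.strB x < v.s) (hmid : 0 < v.mid)
    (hpos : v.i + v.mid + v.offset + 1 < E.size) (haddr : (v.node + 1) * v.s < E.size) :
    Runs E followChild v fun t v' => t ≤ 30 ∧ v'.toProbe = v.toProbe ∧ v'.j = v.j ∧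
      v'.ctr = v.ctr ∧ v'.trie = v.trie ∧ v'.node = v.trie (v.node * v.s +
        sampled (shiftBy v.k E.strB) v.words v.i v.mid v.offset v.j) := by
  have hmod := Nat.mod_lt (v.words v.j) hmid
  set z := v.i + v.words v.j % v.mid + v.offset with hz
  have hchar := hB (z - v.k)
  rw [Nat.add_mul] at haddr
  have hchild : (if v.k < z + 1 then 1 else 0) * E.strB (z - v.k) = shiftBy v.k E.strB z := by
    simp only [shiftBy, Nat.lt_succ_iff, ite_mul, one_mul, zero_mul]
  have hlt := shiftBy_lt (k := v.k) hB z
  refine .seq (.assign (.assign ⟨by simp [Expr.cost], rfl, rfl, rfl, rfl, ?_⟩ ?_))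
  · rw [sampled, ← hz, ← hchild]
    rfl
  · simp only [Expr.Fits, Expr.value, Op.apply, Store.toState_reg, Store.toState_words, Store.get,
      Store.set, true_and, ← hz, hchild]
    split <;> omega

theorem runs_lookupWord (hB : ∀ x, E.strB x < v.s) (hmid : 0 < v.mid)
    (hpos : v.i + v.mid + v.offset + 1 < E.size) (hm : v.m < E.size)
    (hctr : (v.ctr + 1) * v.s < E.size) (hT : IsTrie v.trie v.s v.root v.ctr W) :
    Runs E lookupWord v fun t v' => t ≤ 50 * v.m + 20 ∧ v'.toProbe = v.toProbe ∧
      v'.ctr = v.ctr ∧ v'.trie = v.trie ∧ v'.node = walk v.trie v.s v.root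
        (firstValues (sampled (shiftBy v.k E.strB) v.words v.i v.mid v.offset) v.m) := by
  set f := sampled (shiftBy v.k E.strB) v.words v.i v.mid v.offset
  have hfs : ∀ j, f j < v.s := fun j => shiftBy_lt hB _
  refine .seq (.assign (.seq (.assign (.while_iterate (N := v.m) (c := 50)
    (fun j u => u.toProbe = v.toProbe ∧ u.j = j ∧ u.ctr = v.ctr ∧ u.trie = v.trie ∧
      u.node = walk v.trie v.s v.root (firstValues f j)) ?_ ?_ ?_ ?_))))
  · exact ⟨rfl, rfl, rfl, rfl, rfl⟩
  · rintro j u ⟨hu, rfl, -⟩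
    rw [value_lt_ne_zero, ← congrArg Probe.m hu]
    exact ⟨fits_lt trivial trivial (by omega), Iff.rfl⟩
  · rintro j u ⟨hu, rfl, hctru, htrie, hnode⟩ hj
    have haddr : (u.node + 1) * v.s < E.size := (Nat.mul_le_mul_right _ (Nat.succ_le_succ
      (hnode.trans_le (hT.walk_le _ (forall_mem_firstValues hfs u.j))))).trans_lt hctr
    have hrun := runs_followChild (E := E) (v := u)
    rw [hu] at hrun
    refine .seq ((hrun hB hmid hpos haddr).mono ?_)
    rintro t u' ⟨ht, hu', hj', hctr', htrie', hnode'⟩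
    refine .assign ⟨⟨hu', congrArg (· + 1) hj', hctr'.trans hctru, htrie'.trans htrie, ?_⟩, ?_⟩
    · rw [firstValues_succ, walk_concat, ← hnode, ← htrie]
      exact hnode'
    · simp only [Expr.cost]; omega
  · rintro t u ⟨hu, -, hctru, htrie, hnode⟩ ht
    refine ⟨?_, hu, hctru, htrie, hnode⟩
    simp only [Expr.cost] at ht ⊢
    omega

/-- Insert the sampled characters of the first string at the offsets `0, …, r - 1`. -/
def insertWords : Prog :=
  offset ::= lit 0 ;;
  .while (offset <ₑ r) (insertWord ;; offset ::= offset +ₑ lit 1)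

/-- Look up the sampled characters of the shifted second string at one offset, record a success in
`ok`, and make a giant step. -/
def lookupNext : Prog :=
  lookupWord ;; ite node (ok ::= lit 1) skip ;; offset ::= offset +ₑ r

/-- Look up the sampled characters of the shifted second string at the multiples of `r` up to
`2 * k + r`. -/
def lookupWords : Prog :=
  ok ::= lit 0 ;;
  offset ::= lit 0 ;;
  .while (offset <ₑ k +ₑ k +ₑ r +ₑ lit 1) lookupNext

theorem runs_insertWords (hA : ∀ x, E.strA x < v.s) (hmid : 0 < v.mid)
    (hpos : v.i + v.mid + v.r < E.size) (hctr : (v.ctr + v.r * v.m + 1) * v.s < E.size)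
    (hT : IsTrie v.trie v.s v.root v.ctr {[]}) :
    Runs E insertWords v fun t v' => t ≤ v.r * (50 * v.m + 40) + 10 ∧
      v'.toProbe = { v.toProbe with offset := v.r } ∧ v'.ctr ≤ v.ctr + v.r * v.m ∧
      IsTrie v'.trie v.s v.root v'.ctr ({[]} ∪
        ⋃ y < v.r, firstValues (sampled E.strA v.words v.i v.mid y) '' Set.Iic v.m) := by
  refine .seq (.assign (.while_iterate (N := v.r) (c := 50 * v.m + 40)
    (fun y u => u.toProbe = { v.toProbe with offset := y } ∧ u.ctr ≤ v.ctr + y * v.m ∧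
      IsTrie u.trie v.s v.root u.ctr ({[]} ∪
        ⋃ y' < y, firstValues (sampled E.strA v.words v.i v.mid y') '' Set.Iic v.m)) ?_ ?_ ?_ ?_))
  · exact ⟨rfl, Nat.le_add_right _ _, by simpa [Store.set] using hT⟩
  · rintro y u ⟨hu, -⟩
    refine ⟨fits_lt trivial trivial (by omega), ?_⟩
    rw [value_lt_ne_zero]
    exact Iff.of_eq (congrArg₂ _ (congrArg (·.offset) hu) (congrArg (·.r) hu))
  · rintro y u ⟨hu, hctru, htrie⟩ hy
    have hmul := Nat.mul_le_mul_right v.m (Nat.succ_le_of_lt hy)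
    rw [Nat.succ_eq_add_one, Nat.add_mul] at hmul
    have hrun := runs_insertWord (E := E) (v := u) (W := {[]} ∪
      ⋃ y' < y, firstValues (sampled E.strA v.words v.i v.mid y') '' Set.Iic v.m)
    rw [hu] at hrun
    refine .seq ((hrun hA hmid (by simp only; omega)
      ((Nat.mul_le_mul_right _ (by simp only; omega)).trans_lt hctr) htrie).mono ?_)
    rintro t u' ⟨ht, hu', hctr', htrie'⟩
    have hoffset : u'.offset = y := congrArg (·.offset) hu'
    have hlt : u'.offset + 1 < E.size := by rw [hoffset]; omega
    refine .assign ⟨⟨congrArg (fun p => { p with offset := p.offset + 1 }) hu',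
      hctr'.trans (by simp only; rw [Nat.add_mul]; omega), ?_⟩, ?_⟩
    · rw [Set.biUnion_lt_succ, ← Set.union_assoc]
      exact htrie'
    · simp only [Expr.cost] at ht ⊢; omega
  · rintro t u ⟨hu, hctru, htrie⟩ ht
    refine ⟨?_, hu, hctru, htrie⟩
    simp only [Expr.cost] at ht ⊢
    omega

theorem runs_lookupNext (hB : ∀ x, E.strB x < v.s) (hmid : 0 < v.mid)
    (hpos : v.i + v.mid + v.offset + v.r + 1 < E.size) (hm : v.m < E.size)
    (hctr : (v.ctr + 1) * v.s < E.size) (hT : IsTrie v.trie v.s v.root v.ctr W) :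
    Runs E lookupNext v fun t v' => t ≤ 50 * v.m + 40 ∧
      v'.toProbe = { v.toProbe with offset := v.offset + v.r, ok := v'.ok } ∧
      v'.ctr = v.ctr ∧ v'.trie = v.trie ∧ (v'.ok ≠ 0 ↔ v.ok ≠ 0 ∨
        firstValues (sampled (shiftBy v.k E.strB) v.words v.i v.mid v.offset) v.m ∈ W) := by
  refine .seq ((runs_lookupWord hB hmid (by omega) hm hctr hT).mono ?_)
  rintro t u ⟨ht, hu, hctru, htrie, hnode⟩
  have hmem := hT.walk_ne_zero_iff _ (forall_mem_firstValues
    (f := sampled (shiftBy v.k E.strB) v.words v.i v.mid v.offset) (fun j => shiftBy_lt hB _) v.m)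
  have hnext : ∀ b, { u.toProbe with offset := u.offset + u.r, ok := b } =
      { v.toProbe with offset := v.offset + v.r, ok := b } := fun b => by rw [hu]
  have hoffset : u.offset + u.r < E.size := by rw [hu]; omega
  refine .seq (.ite (fun h => .assign (.assign ⟨?_, hnext 1, hctru, htrie, ?_⟩))
    fun h => .skip (.assign ⟨?_, hnext u.ok, hctru, htrie, ?_⟩))
  · simp only [Expr.cost]; omega
  · exact iff_of_true one_ne_zero (.inr (hmem.1 (hnode ▸ h)))
  · simp only [Expr.cost]; omega
  · rw [← show u.ok = v.ok from congrArg (·.ok) hu]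
    exact (or_iff_left fun hW => (hmem.2 hW) (hnode ▸ h)).symm

theorem runs_lookupWords (hB : ∀ x, E.strB x < v.s) (hmid : 0 < v.mid) (hr : 0 < v.r)
    (hpos : v.i + v.mid + 2 * v.k + 2 * v.r + 1 < E.size) (hm : v.m < E.size)
    (hctr : (v.ctr + 1) * v.s < E.size) (hT : IsTrie v.trie v.s v.root v.ctr W) :
    Runs E lookupWords v fun t v' => t ≤ ((2 * v.k + v.r) / v.r + 1) * (50 * v.m + 50) + 20 ∧
      v'.toSearch = v.toSearch ∧ v'.ctr = v.ctr ∧ v'.trie = v.trie ∧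
      (v'.ok ≠ 0 ↔ ∃ a, a * v.r ≤ 2 * v.k + v.r ∧ firstValues
        (sampled (shiftBy v.k E.strB) v.words v.i v.mid (a * v.r)) v.m ∈ W) := by
  have hlt : ∀ a, a < (2 * v.k + v.r) / v.r + 1 ↔ a * v.r ≤ 2 * v.k + v.r :=
    fun a => Nat.lt_succ_iff.trans (Nat.le_div_iff_mul_le hr)
  refine .seq (.assign (.seq (.assign (.while_iterate
    (N := (2 * v.k + v.r) / v.r + 1) (c := 50 * v.m + 50)
    (fun a u => u.toProbe = { v.toProbe with offset := a * v.r, ok := u.ok } ∧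
      u.ctr = v.ctr ∧ u.trie = v.trie ∧ (u.ok ≠ 0 ↔ ∃ a' < a, firstValues
        (sampled (shiftBy v.k E.strB) v.words v.i v.mid (a' * v.r)) v.m ∈ W)) ?_ ?_ ?_ ?_))))
  · exact ⟨by simp [Store.set, value], rfl, rfl, by simp [Store.set, value]⟩
  · rintro a u ⟨hu, -⟩
    have hk : u.k = v.k := congrArg (·.k) hu
    have hur : u.r = v.r := congrArg (·.r) hu
    have hoffset : u.offset = a * v.r := congrArg (·.offset) hu
    refine ⟨fits_lt trivial ?_ (by omega), ?_⟩
    · simp only [Expr.Fits, Expr.value, Op.apply, Store.toState_reg, Store.get, true_and]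
      omega
    · rw [value_lt_ne_zero, hlt]
      simp only [Expr.value, Op.apply, Store.toState_reg, Store.get]
      omega
  · rintro a u ⟨hu, hctru, htrie, hok⟩ ha
    have hrun := runs_lookupNext (E := E) (v := u) (W := W)
    rw [hu, hctru, htrie] at hrun
    have := (hlt a).1 ha
    refine (hrun hB hmid (by simp only; omega) hm hctr hT).mono ?_
    rintro t u' ⟨ht, hu', hctr', htrie', hok'⟩
    refine ⟨⟨?_, hctr', htrie', ?_⟩, ?_⟩
    · rw [hu', Nat.add_mul, one_mul]
    · rw [hok', Nat.exists_lt_succ_right, or_congr_left]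
      exact hok
    · simp only [Expr.cost] at ht ⊢; omega
  · rintro t u ⟨hu, hctru, htrie, hok⟩ ht
    refine ⟨?_, congrArg (·.toSearch) hu, hctru, htrie, ?_⟩
    · simp only [Expr.cost] at ht ⊢; omega
    · simp only [hok, hlt]

/-- Test the window of length `mid` at `i`, with a new trie. -/
def testWindow : Prog :=
  m ::= (mid /ₑ k +ₑ lit 1) *ₑ L ;;
  ctr ::= ctr +ₑ lit 1 ;;
  root ::= ctr ;;
  insertWords ;;
  lookupWords

theorem mem_words_iff_passes {f g R : ℕ → ℕ} {k r L i l m : ℕ} (hm : m = numSamples k L l)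
    (hpos : 0 < m) :
    (∃ a, a * r ≤ 2 * k + r ∧ firstValues (sampled (shiftBy k g) R i l (a * r)) m ∈
      {[]} ∪ ⋃ y < r, firstValues (sampled f R i l y) '' Set.Iic m) ↔
        Passes f g k r L R i l := by
  have hne : ∀ f, firstValues f m ≠ [] := fun f => by simp [firstValues, hpos.ne']
  simp only [Passes, ← hm, Set.singleton_union, Set.mem_insert_iff, hne, false_or, Set.mem_iUnion,
    Set.mem_image, firstValues_eq_iff]
  constructor
  · rintro ⟨a, ha, b, hb, _, -, rfl, heq⟩
    exact ⟨b, hb, a, ha, heq⟩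
  · rintro ⟨b, hb, a, ha, heq⟩
    exact ⟨a, ha, b, hb, m, Set.self_mem_Iic, rfl, heq⟩

theorem giantSteps_le {k r : ℕ} (hr : k < r * r) : (2 * k + r) / r + 1 ≤ 2 * r + 1 := by
  refine Nat.succ_le_succ (Nat.lt_succ_iff.1 (Nat.div_lt_of_lt_mul ?_))
  rw [Nat.mul_succ, Nat.mul_left_comm]
  omega

theorem runs_testWindow (hA : ∀ x, E.strA x < v.s) (hB : ∀ x, E.strB x < v.s) (hmid : 0 < v.mid)
    (hr : v.k < v.r * v.r) (hL : 0 < v.L)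
    (hpos : v.i + v.mid + 2 * v.k + 2 * v.r + 1 < E.size)
    (hm : numSamples v.k v.L v.mid < E.size)
    (hctr : (v.ctr + v.r * numSamples v.k v.L v.mid + 2) * v.s < E.size)
    (hT : Blank v.trie v.s v.ctr) :
    Runs E testWindow v fun t v' => t ≤ 500 * (v.r * numSamples v.k v.L v.mid) ∧
      v'.toSearch = v.toSearch ∧ v'.ctr ≤ v.ctr + v.r * numSamples v.k v.L v.mid + 1 ∧
      Blank v'.trie v.s v'.ctr ∧
      (v'.ok ≠ 0 ↔ Passes E.strA E.strB v.k v.r v.L v.words v.i v.mid) := by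
  set M := numSamples v.k v.L v.mid with hM
  have hMpos : 0 < M := numSamples_pos _ _ hL
  have hr0 : 0 < v.r := Nat.pos_of_mul_pos_left (Nat.zero_lt_of_lt hr)
  have hrM : M ≤ v.r * M := Nat.le_mul_of_pos_left _ hr0
  have hrM' : v.r ≤ v.r * M := Nat.le_mul_of_pos_right _ hMpos
  have hs : v.ctr + 1 < E.size := by
    have := Nat.le_mul_of_pos_right (v.ctr + v.r * M + 2) ((Nat.zero_le _).trans_lt (hA 0))
    omega
  have hdiv := Nat.div_le_self v.mid v.k
  have hmfits : (v.mid / v.k + 1) * v.L < E.size := hm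
  refine .seq (.assign (.seq (.assign (.seq (.assign (.seq ((runs_insertWords
    (v := { v with m := M, ctr := v.ctr + 1, root := v.ctr + 1 }) hA hmid ?_ ?_
      hT.isTrie_singleton).mono ?_)))))))
  · simp only; omega
  · simp only; rwa [show v.ctr + 1 + v.r * M + 1 = v.ctr + v.r * M + 2 by omega]
  rintro t u ⟨ht, hu, hctru, htrie⟩
  have hrun := runs_lookupWords (E := E) (v := u) (W := {[]} ∪
    ⋃ y < v.r, firstValues (sampled E.strA v.words v.i v.mid y) '' Set.Iic M)
  rw [hu] at hrun
  refine (hrun hB hmid hr0 (by simp only; omega) hm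
    ((Nat.mul_le_mul_right _ (by simp only at hctru; omega)).trans_lt hctr) htrie).mono ?_
  rintro t' u' ⟨ht', hu', hctr', htrie', hok⟩
  refine ⟨?_, hu', ?_, ?_, hok.trans (mem_words_iff_passes hM hMpos)⟩
  · have hgiant := Nat.mul_le_mul_right (50 * M + 50) (giantSteps_le hr)
    have hbaby : v.r * (50 * M + 40) = 50 * (v.r * M) + 40 * v.r := by ring
    rw [show (2 * v.r + 1) * (50 * M + 50) = 100 * (v.r * M) + 100 * v.r + 50 * M + 50 by ring]
      at hgiant
    simp only [Expr.cost] at ht ht' ⊢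
    omega
  · exact hctr'.trans_le (hctru.trans (by simp only; omega))
  · rw [hctr', htrie']
    exact htrie.toBlank

/-- The outcome of the test of a window of the input strings. -/
def Params.Passes (p : Params) (E : Env) : ℕ → ℕ → Prop :=
  GapED.Passes E.strA E.strB p.k p.r p.L p.words

/-- Bound on the number of windows tested in a round. -/
def Params.maxTests (p : Params) : ℕ := 2 * (Nat.log 2 p.n + 1)

/-- Bound on the number of trie nodes created in the test of a window. -/
def Params.testNodes (p : Params) : ℕ := p.r * numSamples p.k p.L p.n + 1

/-- The input and the parameters fit into the words of the machine, and so does the trie of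
`k + 1` rounds. -/
structure Params.Valid (p : Params) (E : Env) : Prop where
  strA_lt : ∀ x, E.strA x < p.s
  strB_lt : ∀ x, E.strB x < p.s
  lt_mul_self : p.k < p.r * p.r
  r_le : p.r ≤ p.n
  L_pos : 0 < p.L
  pos_fits : 2 * p.n + 2 * p.k + 2 * p.r + 5 < E.size
  numSamples_fits : numSamples p.k p.L p.n + 1 < E.size
  ctr_fits : ((p.k + 1) * (p.maxTests * p.testNodes) + 2) * p.s < E.size

theorem Params.Valid.r_pos {p : Params} (h : p.Valid E) : 0 < p.r :=
  Nat.pos_of_mul_pos_left (Nat.zero_lt_of_lt h.lt_mul_self)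

/-- Set `mid` to the next length to be tested. -/
def chooseMid : Prog :=
  mid ::= lo +ₑ lo +ₑ lit 1 ;;
  ite ((lo +ₑ hi) /ₑ lit 2 <ₑ mid) (mid ::= (lo +ₑ hi) /ₑ lit 2) skip

/-- Test the next length and narrow down the range of lengths. -/
def searchStep : Prog :=
  chooseMid ;; testWindow ;; ite ok (lo ::= mid) (hi ::= mid)

/-- Find the length of the round at `i`. -/
def searchLength : Prog :=
  lo ::= lit 0 ;;
  hi ::= n -ₑ (i +ₑ r) +ₑ lit 1 ;;
  .while (lo +ₑ lit 1 <ₑ hi) searchStep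

theorem runs_chooseMid (h : v.lo < v.hi) (hsize : 2 * v.hi + 1 < E.size) :
    Runs E chooseMid v fun t v' => t ≤ 20 ∧
      v' = { v with mid := nextLength v.lo v.hi } := by
  have hdiv := Nat.div_le_self (v.lo + v.hi) 2
  refine .seq (.assign (.ite (fun hlt => .assign ⟨?_, ?_⟩) (fun hge => .skip ⟨?_, ?_⟩)
    (fits_lt ?_ trivial (by omega))))
  · simp only [Expr.cost]; omega
  · have hlt' := value_lt_ne_zero.1 hlt
    exact congrArg (fun x => { v with mid := x })
      (min_eq_right_of_lt hlt').symm
  · simp only [Expr.cost]; omega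
  · have hge' := not_lt.1 (mt value_lt_ne_zero.2 (not_not.2 hge))
    exact congrArg (fun x => { v with mid := x }) (min_eq_left hge').symm
  · simp only [Expr.Fits, Expr.value, Op.apply, Store.toState_reg, Store.get, Store.set, true_and]
    omega

theorem runs_searchStep {N e : ℕ} (hV : v.toParams.Valid E) (hi : v.i ≤ v.n)
    (hb : Bracket (v.toParams.Passes E v.i) N v.lo v.hi) (hN : N ≤ v.n) (hNe : N ≤ 2 ^ e)
    (hlt : v.lo + 1 < v.hi) (hctr : (v.ctr + v.toParams.testNodes + 1) * v.s < E.size)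
    (hT : Blank v.trie v.s v.ctr) :
    Runs E searchStep v fun t v' =>
      t ≤ 530 * (v.r * numSamples v.k v.L (2 * v.lo + 1)) ∧
      v'.toProgress = v.toProgress ∧ v'.ctr ≤ v.ctr + v.toParams.testNodes ∧
      Blank v'.trie v.s v'.ctr ∧ v.lo ≤ v'.lo ∧
      Bracket (v.toParams.Passes E v.i) N v'.lo v'.hi ∧
      searchSteps e v'.lo v'.hi < searchSteps e v.lo v.hi := by
  have hsize := hV.pos_fits
  have hhi := hb.hi_le
  refine .seq ((runs_chooseMid hb.lo_lt (by omega)).mono ?_)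
  rintro t₁ _ ⟨ht₁, rfl⟩
  set l := nextLength v.lo v.hi with hl
  have hlo : v.lo < l := lt_nextLength hlt
  have hlhi : l < v.hi := nextLength_lt hb.lo_lt
  have hnodes : v.r * numSamples v.k v.L l + 1 ≤ v.toParams.testNodes :=
    Nat.succ_le_succ (Nat.mul_le_mul_left _ (numSamples_mono _ _ (by omega)))
  refine .seq ((runs_testWindow (E := E) (v := { v with mid := l }) hV.strA_lt hV.strB_lt
    (Nat.zero_lt_of_lt hlo) hV.lt_mul_self hV.L_pos (by simp only; omega)
    ((numSamples_mono _ _ (show l ≤ v.n by omega)).trans_lt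
      ((Nat.lt_succ_self _).trans hV.numSamples_fits))
    ((Nat.mul_le_mul_right _ (by simp only; omega)).trans_lt hctr) hT).mono ?_)
  rintro t₂ u ⟨ht₂, hu, hctru, htrie, hok⟩
  have hmid : u.mid = l := congrArg (·.mid) hu
  have hctr' : u.ctr ≤ v.ctr + v.toParams.testNodes := hctru.trans (by simp only; omega)
  have htime : v.r * numSamples v.k v.L l ≤ v.r * numSamples v.k v.L (2 * v.lo + 1) :=
    Nat.mul_le_mul_left _ (numSamples_mono _ _ (hl ▸ (min_le_left _ _).trans (by omega)))
  have hpos : 0 < v.r * numSamples v.k v.L l := Nat.mul_pos hV.r_pos (numSamples_pos _ _ hV.L_pos)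
  have hprogress : u.toProgress = v.toProgress := congrArg (·.toProgress) hu
  refine .ite (fun h => .assign ⟨?_, hprogress, hctr', htrie, ?_⟩)
    (fun h => .assign ⟨?_, hprogress, hctr', htrie, ?_⟩) trivial
  · simp only [Expr.cost] at ht₂ ⊢; omega
  · have huhi : u.hi = v.hi := congrArg (·.hi) hu
    simp only [Store.set, value, Store.toState_reg, Store.get, hmid, huhi]
    exact ⟨hlo.le, ⟨hlhi, hb.hi_le, .inr (hok.1 h), hb.hi_fail⟩,
      searchSteps_right_lt hlt (hb.hi_le.trans hNe)⟩
  · simp only [Expr.cost] at ht₂ ⊢; omega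
  · have hulo : u.lo = v.lo := congrArg (·.lo) hu
    simp only [Store.set, value, Store.toState_reg, Store.get, hmid, hulo]
    exact ⟨le_rfl, ⟨hlo, hlhi.le.trans hb.hi_le, hb.lo_pass, .inr (mt hok.2 (not_not.2 h))⟩,
      searchSteps_left_lt hlt⟩

/-- Invariant of the search for the length of a round which started in the store `v`, after `j`
tests and `τ` steps. -/
structure SearchInv (E : Env) (v : Store) (j τ : ℕ) (u : Store) : Prop where
  progress : u.toProgress = v.toProgress
  bracket : Bracket (v.toParams.Passes E v.i) (v.n - (v.i + v.r) + 1) u.lo u.hi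
  steps : j + searchSteps (Nat.log 2 v.n + 1) u.lo u.hi ≤ v.toParams.maxTests
  time : τ ≤ j * (550 * (v.r * numSamples v.k v.L (2 * u.lo + 1)))
  ctr_le : u.ctr ≤ v.ctr + j * v.toParams.testNodes
  blank : Blank u.trie v.s u.ctr

theorem SearchInv.step {u : Store} {j τ : ℕ} (hV : v.toParams.Valid E) (hi : v.i ≤ v.n)
    (hctr : (v.ctr + v.toParams.maxTests * v.toParams.testNodes + 2) * v.s < E.size)
    (h : SearchInv E v j τ u) (hlt : u.lo + 1 < u.hi) :
    Runs E searchStep u fun t u' => SearchInv E v (j + 1) (τ + (6 + t)) u' ∧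
      searchSteps (Nat.log 2 v.n + 1) u'.lo u'.hi < searchSteps (Nat.log 2 v.n + 1) u.lo u.hi := by
  obtain ⟨hu, hb, hsteps, htime, hctru, htrie⟩ := h
  have hn : v.n - (v.i + v.r) + 1 ≤ v.n := by
    have := hV.r_pos
    have := hV.r_le
    omega
  have hpow := (hn.trans_lt (Nat.lt_pow_succ_log_self one_lt_two v.n)).le
  have hspos : 0 < searchSteps (Nat.log 2 v.n + 1) u.lo u.hi :=
    Nat.add_pos_left (Nat.clog_pos one_lt_two (by omega)) _
  have hmul := Nat.mul_le_mul_right v.toParams.testNodes (show j + 1 ≤ v.toParams.maxTests by omega)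
  rw [Nat.add_mul, one_mul] at hmul
  have hrun := runs_searchStep (E := E) (v := u) (N := v.n - (v.i + v.r) + 1)
    (e := Nat.log 2 v.n + 1)
  rw [hu] at hrun
  refine (hrun hV hi hb hn hpow hlt ((Nat.mul_le_mul_right _ (by omega)).trans_lt hctr)
    htrie).mono ?_
  rintro t u' ⟨ht, hu', hctr', htrie', hlo, hb', hlt'⟩
  refine ⟨⟨hu', hb', by omega, ?_, by rw [Nat.add_mul]; omega, htrie'⟩, hlt'⟩
  have hmono : v.r * numSamples v.k v.L (2 * u.lo + 1) ≤
      v.r * numSamples v.k v.L (2 * u'.lo + 1) :=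
    Nat.mul_le_mul_left _ (numSamples_mono _ _ (by omega))
  have hpos : 0 < v.r * numSamples v.k v.L (2 * u.lo + 1) :=
    Nat.mul_pos hV.r_pos (numSamples_pos _ _ hV.L_pos)
  have hmul' := Nat.mul_le_mul_left j (Nat.mul_le_mul_left 550 hmono)
  rw [Nat.add_mul]
  omega

theorem runs_searchLength (hV : v.toParams.Valid E) (hi : v.i ≤ v.n)
    (hctr : (v.ctr + v.toParams.maxTests * v.toParams.testNodes + 2) * v.s < E.size)
    (hT : Blank v.trie v.s v.ctr) :
    Runs E searchLength v fun t v' =>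
      t ≤ v.toParams.maxTests * (550 * (v.r * numSamples v.k v.L (2 * v'.lo + 1))) + 20 ∧
      v'.toProgress = v.toProgress ∧
      v'.ctr ≤ v.ctr + v.toParams.maxTests * v.toParams.testNodes ∧
      Blank v'.trie v.s v'.ctr ∧ IsRound (v.toParams.Passes E) v.n v.r v.i v'.lo := by
  have hsize := hV.pos_fits
  refine .seq (.assign (.seq (.assign (.while_elapsed
    (fun τ μ u => ∃ j, SearchInv E v j τ u ∧ μ = searchSteps (Nat.log 2 v.n + 1) u.lo u.hi)
    ⟨0, ⟨rfl, ⟨Nat.succ_pos _, le_rfl, .inl rfl, .inl rfl⟩, ?_, Nat.zero_le _,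
      Nat.le_add_right _ _, hT⟩, rfl⟩ ?_ ?_ ?_))))
  · rw [zero_add]
    refine searchSteps_zero_le ((?_ : _ ≤ v.n + 1).trans (Nat.lt_pow_succ_log_self one_lt_two v.n))
    simp only [Store.set, value, Op.apply, Store.toState_reg, Store.get]
    omega
  · rintro τ _ u ⟨j, h, -⟩
    have := h.bracket.lo_lt
    have := h.bracket.hi_le
    exact fits_lt ⟨trivial, by simp only [Expr.Fits]; omega,
      by simp only [value, Op.apply, Store.toState_reg, Store.get]; omega⟩ trivial (by omega)
  · rintro τ _ u ⟨j, h, rfl⟩ hne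
    exact (h.step hV hi hctr (value_lt_ne_zero.1 hne)).mono fun t u' ⟨h', hlt⟩ =>
      ⟨_, hlt, j + 1, h', rfl⟩
  · rintro τ _ u ⟨j, h, -⟩ hzero
    have hhi : ¬u.lo + 1 < u.hi := fun h => absurd hzero (value_lt_ne_zero.2 h)
    have hj := Nat.le_of_add_right_le h.steps
    refine ⟨?_, h.progress, h.ctr_le.trans (Nat.add_le_add_left (Nat.mul_le_mul_right _ hj) _),
      h.blank, h.bracket.isRound (not_lt.1 hhi)⟩
    have := h.time.trans (Nat.mul_le_mul_right _ hj)
    simp only [Expr.cost]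
    omega

/-- One round of the greedy algorithm. -/
def greedyRound : Prog :=
  searchLength ;;
  i ::= i +ₑ lo +ₑ lit 1 +ₑ r ;;
  g ::= g +ₑ lit 1

theorem runs_greedyRound (hV : v.toParams.Valid E) (hi : v.i ≤ v.n) (hg : v.g ≤ v.k)
    (hctr : v.ctr ≤ v.g * (v.toParams.maxTests * v.toParams.testNodes))
    (hT : Blank v.trie v.s v.ctr) :
    Runs E greedyRound v fun t v' => ∃ l, IsRound (v.toParams.Passes E) v.n v.r v.i l ∧
      t ≤ v.toParams.maxTests * (550 * (v.r * numSamples v.k v.L (2 * l + 1))) + 50 ∧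
      v'.toProgress = { v.toProgress with i := v.i + l + 1 + v.r, g := v.g + 1 } ∧
      v'.ctr ≤ (v.g + 1) * (v.toParams.maxTests * v.toParams.testNodes) ∧
      Blank v'.trie v.s v'.ctr := by
  have hsize := hV.pos_fits
  have hround := Nat.mul_le_mul_right (v.toParams.maxTests * v.toParams.testNodes)
    (Nat.succ_le_succ hg)
  rw [Nat.succ_eq_add_one, Nat.succ_eq_add_one, Nat.add_mul v.g, one_mul] at hround
  refine .seq ((runs_searchLength hV hi
    ((Nat.mul_le_mul_right _ (by omega)).trans_lt hV.ctr_fits) hT).mono ?_)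
  rintro t u ⟨ht, hu, hctru, htrie, hl⟩
  have hlo : u.lo ≤ v.n := hl.1.elim (by omega) fun h => by omega
  have hr := hV.r_le
  have hui : u.i = v.i := congrArg (·.i) hu
  have hug : u.g = v.g := congrArg (·.g) hu
  have hur : u.r = v.r := congrArg (·.r) hu
  refine .seq (.assign (.assign ⟨u.lo, hl, ?_, congrArg
    (fun p => { p with i := p.i + u.lo + 1 + p.r, g := p.g + 1 }) hu, ?_, htrie⟩))
  · simp only [Expr.cost]; omega
  · exact hctru.trans (by rw [Nat.add_mul]; omega)

/-- Set `r` to `⌊√k⌋ + 1`. -/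
def computeR : Prog :=
  r ::= lit 1 ;;
  .while (r *ₑ r <ₑ k +ₑ lit 1) (r ::= r +ₑ lit 1)

theorem runs_computeR (hk : (v.k + 2) * (v.k + 2) < E.size) :
    Runs E computeR v fun t v' => t ≤ 20 * (Nat.sqrt v.k + 1) ∧
      v' = { v with r := Nat.sqrt v.k + 1 } := by
  have hsqrt := Nat.sqrt_le_self v.k
  have hk' : v.k + 2 ≤ (v.k + 2) * (v.k + 2) := Nat.le_mul_self _
  refine .seq (.assign (.while_iterate (N := Nat.sqrt v.k) (c := 15)
    (fun j u => u = { v with r := j + 1 } ∧ j ≤ Nat.sqrt v.k) ⟨rfl, Nat.zero_le _⟩ ?_ ?_ ?_))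
  · rintro j _ ⟨rfl, hj⟩
    have hmul : (j + 1) * (j + 1) ≤ (v.k + 2) * (v.k + 2) :=
      Nat.mul_le_mul (by omega) (by omega)
    refine ⟨fits_lt ⟨trivial, trivial, ?_⟩ ⟨trivial, ?_, ?_⟩ (by omega), ?_⟩
    · exact hmul.trans_lt hk
    · simp only [Expr.Fits]; omega
    · simp only [value, Op.apply, Store.toState_reg, Store.get]; omega
    · rw [value_lt_ne_zero, ← Nat.succ_le_iff (m := j), Nat.le_sqrt]
      exact Nat.lt_succ_iff
  · rintro j _ ⟨rfl, -⟩ hj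
    exact .assign ⟨⟨rfl, hj⟩, by simp only [Expr.cost]; omega⟩
  · rintro t _ ⟨rfl, -⟩ ht
    refine ⟨?_, rfl⟩
    simp only [Expr.cost] at ht ⊢
    omega

/-- Set `L` to `16 * (⌊log₂ n⌋ + 1)`. -/
def computeL : Prog :=
  L ::= lit 0 ;;
  q ::= lit 1 ;;
  .while (q <ₑ n +ₑ lit 1) (q ::= q +ₑ q ;; L ::= L +ₑ lit 16)

theorem runs_computeL (hn : v.n ≠ 0) (hpos : 2 * v.n + 1 < E.size)
    (hL : 16 * (Nat.log 2 v.n + 1) < E.size) :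
    Runs E computeL v fun t v' => t ≤ 30 * (Nat.log 2 v.n + 1) ∧
      v' = { v with L := 16 * (Nat.log 2 v.n + 1), q := 2 ^ (Nat.log 2 v.n + 1) } := by
  refine .seq (.assign (.seq (.assign (.while_iterate (N := Nat.log 2 v.n + 1) (c := 20)
    (fun j u => u = { v with L := 16 * j, q := 2 ^ j }) rfl ?_ ?_ ?_))))
  · rintro j _ rfl
    refine ⟨fits_lt trivial ⟨trivial, ?_, ?_⟩ (by omega), ?_⟩
    · simp only [Expr.Fits]; omega
    · simp only [value, Op.apply, Store.toState_reg, Store.get]; omega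
    · rw [value_lt_ne_zero, Nat.lt_succ_iff, Nat.le_log_iff_pow_le one_lt_two hn]
      exact Nat.lt_succ_iff
  · rintro j _ rfl hj
    have hle : 2 ^ j ≤ v.n := (Nat.le_log_iff_pow_le one_lt_two hn).1 (Nat.le_of_lt_succ hj)
    refine .seq (.assign (.assign ⟨?_, by simp only [Expr.cost]; omega⟩))
    rw [pow_succ, mul_two, Nat.mul_add]
    rfl
  · rintro t _ rfl ht
    refine ⟨?_, rfl⟩
    simp only [Expr.cost] at ht ⊢
    omega

/-- The first `M` words of a tape, continued by zeros. -/
def tapeInit (τ : ℕ → ℕ) (M a : ℕ) : ℕ := if a < M then τ a else 0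

theorem tapeInit_zero (τ : ℕ → ℕ) : tapeInit τ 0 = fun _ => 0 :=
  funext fun a => if_neg a.not_lt_zero

theorem tapeInit_succ (τ : ℕ → ℕ) (M : ℕ) :
    tapeInit τ (M + 1) = Function.update (tapeInit τ M) M (τ M) := by
  funext a
  rcases eq_or_ne a M with rfl | h
  · rw [Function.update_self, tapeInit, if_pos a.lt_succ_self]
  · rw [Function.update_of_ne h, tapeInit, tapeInit]
    exact if_congr (by omega) rfl rfl

/-- Draw a random word and store it. -/
def drawWord : Prog :=
  .rand q.index ;; store 1 j q ;; j ::= j +ₑ lit 1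

/-- Draw and store the random words. -/
def drawWords : Prog :=
  m ::= (n /ₑ k +ₑ lit 1) *ₑ L ;;
  j ::= lit 0 ;;
  .while (j <ₑ m) drawWord

theorem runs_drawWord (hj : v.j + 1 < E.size) :
    Runs E drawWord v fun t v' => t ≤ 10 ∧ v' = { v with
      pos := v.pos + 1, words := Function.update v.words v.j (E.tape v.pos), j := v.j + 1,
      q := E.tape v.pos } :=
  .seq (.rand (.seq (.store_words (.assign ⟨by simp only [Expr.cost]; omega, rfl⟩)
    ⟨trivial, trivial⟩)))

theorem runs_drawWords (hL : 0 < v.L) (hm : numSamples v.k v.L v.n + 1 < E.size)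
    (hwords : v.words = fun _ => 0) (hpos : v.pos = 0) :
    Runs E drawWords v fun t v' => t ≤ 20 * numSamples v.k v.L v.n + 20 ∧
      v'.toProgress = { v.toProgress with
        words := tapeInit E.tape (numSamples v.k v.L v.n), pos := numSamples v.k v.L v.n } ∧
      v'.ctr = v.ctr ∧ v'.trie = v.trie := by
  set M := numSamples v.k v.L v.n
  have hdiv : v.n / v.k + 1 ≤ M := Nat.le_mul_of_pos_right _ hL
  have hM' : (v.n / v.k + 1) * v.L = M := rfl
  refine .seq (.assign (.seq (.assign (.while_iterate (N := M) (c := 15) (fun j u => u =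
    { v with m := M, j := j, pos := j, words := tapeInit E.tape j, q := u.q }) ?_ ?_ ?_ ?_))))
  · have hv : v = { v with words := tapeInit E.tape 0, pos := 0 } := by
      rw [tapeInit_zero, ← hwords, ← hpos]
    exact congrArg (fun u : Store => { u with m := M, j := 0 }) hv
  · intro j u hu
    refine ⟨fits_lt trivial trivial (by omega), ?_⟩
    rw [value_lt_ne_zero, hu]
    rfl
  · intro j u hu hj
    have huj : u.j = j := congrArg (·.j) hu
    refine (runs_drawWord (by omega)).mono ?_
    rintro t u' ⟨ht, rfl⟩
    refine ⟨?_, by simp only [Expr.cost]; omega⟩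
    rw [hu, tapeInit_succ]
  · rintro t u hu ht
    refine ⟨?_, by rw [hu], by rw [hu], by rw [hu]⟩
    simp only [Expr.cost] at ht ⊢
    omega

/-- Greedy rounds until the string or the budget of `k + 1` rounds is exhausted. -/
def greedyRounds : Prog :=
  .while ((i <ₑ n +ₑ lit 1) *ₑ (g <ₑ k +ₑ lit 1)) greedyRound

/-- Invariant of the greedy rounds, after `τ` steps. -/
structure GreedyInv (E : Env) (p : Params) (τ : ℕ) (u : Store) : Prop where
  params : u.toParams = p
  rounds : Rounds (p.Passes E) p.n p.r u.g u.i
  g_le : u.g ≤ p.k + 1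
  i_le : u.i ≤ 2 * p.n + 1
  time : τ ≤ 600 * (p.maxTests * (p.r * p.L)) * (2 * u.i / p.k + u.g)
  ctr_le : u.ctr ≤ u.g * (p.maxTests * p.testNodes)
  blank : Blank u.trie p.s u.ctr

theorem roundTime_le {k r L c l i i' : ℕ} (hc : 2 ≤ c) (hr : 0 < r) (hL : 0 < L)
    (hi : i + l + 1 ≤ i') (g : ℕ) :
    600 * (c * (r * L)) * (2 * i / k + g) + (c * (550 * (r * numSamples k L (2 * l + 1))) + 62) ≤
      600 * (c * (r * L)) * (2 * i' / k + (g + 1)) := by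
  set D := c * (r * L)
  have hD1 : 2 ≤ D := hc.trans (Nat.le_mul_of_pos_right _ (Nat.mul_pos hr hL))
  set d := (2 * l + 1) / k
  have hd : 2 * i / k + d ≤ 2 * i' / k :=
    Nat.div_add_div_le_add_div.trans (Nat.div_le_div_right (by omega))
  have hround : c * (550 * (r * numSamples k L (2 * l + 1))) = 550 * (D * (d + 1)) := by
    unfold numSamples; ring
  have hDd : D ≤ D * (d + 1) := Nat.le_mul_of_pos_right _ (Nat.succ_pos _)
  calc 600 * D * (2 * i / k + g) + (c * (550 * (r * numSamples k L (2 * l + 1))) + 62)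
      ≤ 600 * D * (2 * i / k + g) + 600 * (D * (d + 1)) := by omega
    _ = 600 * D * (2 * i / k + d + (g + 1)) := by ring
    _ ≤ 600 * D * (2 * i' / k + (g + 1)) := Nat.mul_le_mul_left _ (by omega)

theorem GreedyInv.step {p : Params} {τ : ℕ} {u : Store} (hV : p.Valid E) (h : GreedyInv E p τ u)
    (hi : u.i ≤ p.n) (hg : u.g ≤ p.k) :
    Runs E greedyRound u fun t u' => GreedyInv E p (τ + (12 + t)) u' ∧ u'.g = u.g + 1 := by
  obtain ⟨rfl, hrounds, -, -, htime, hctr, htrie⟩ := h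
  refine (runs_greedyRound hV hi hg hctr htrie).mono ?_
  rintro t u' ⟨l, hl, ht, hu', hctr', htrie'⟩
  have hui : u'.i = u.i + l + 1 + u.r := congrArg (·.i) hu'
  have hug : u'.g = u.g + 1 := congrArg (·.g) hu'
  have hr := hV.r_le
  have hln : u.i + l + 1 + u.r ≤ 2 * u.n + 1 := hl.1.elim (by omega) fun h => by omega
  refine ⟨⟨congrArg (·.toParams) hu', ?_, by omega, by omega, ?_, ?_, htrie'⟩, hug⟩
  · rw [hui, hug]
    exact hrounds.succ hi hl
  · have hround := roundTime_le (k := u.k) (c := u.toParams.maxTests)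
      (by unfold Params.maxTests; omega) hV.r_pos hV.L_pos (show u.i + l + 1 ≤ u'.i by omega) u.g
    rw [hug]
    omega
  · rwa [hug]

theorem runs_greedyRounds {p : Params} (hV : p.Valid E) (h : GreedyInv E p 0 v) :
    Runs E greedyRounds v fun t v' => ∃ τ, GreedyInv E p τ v' ∧ t ≤ τ + 12 ∧
      (p.n < v'.i ∨ v'.g = p.k + 1) := by
  have hsize := hV.pos_fits
  have hcond : ∀ u : Store, u.toParams = p →
      (value E u.toState ((i <ₑ n +ₑ lit 1) *ₑ (g <ₑ k +ₑ lit 1)) ≠ 0 ↔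
        u.i < p.n + 1 ∧ u.g < p.k + 1) := by
    rintro u rfl
    exact mul_ne_zero_iff.trans (and_congr value_lt_ne_zero value_lt_ne_zero)
  refine .while_elapsed (fun τ μ u => GreedyInv E p τ u ∧ μ = p.k + 1 - u.g) ⟨h, rfl⟩ ?_ ?_ ?_
  · rintro τ _ u ⟨⟨rfl, -⟩, -⟩
    refine ⟨fits_lt trivial ⟨trivial, ?_, ?_⟩ (by omega), fits_lt trivial ⟨trivial, ?_, ?_⟩
      (by omega), ?_⟩
    all_goals
      simp only [Expr.Fits, value, Op.apply, Store.toState_reg, Store.get]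
      try split_ifs
    all_goals omega
  · rintro τ _ u ⟨hu, rfl⟩ hne
    obtain ⟨hi, hg⟩ := (hcond u hu.params).1 hne
    exact (hu.step hV (Nat.le_of_lt_succ hi) (Nat.le_of_lt_succ hg)).mono
      fun t u' ⟨hu', _⟩ => ⟨_, by omega, hu', rfl⟩
  · rintro τ _ u ⟨hu, -⟩ hzero
    refine ⟨τ, hu, by simp only [Expr.cost]; omega, ?_⟩
    have hexit := mt (hcond u hu.params).2 (not_not.2 hzero)
    have := hu.g_le
    omega

/-- Compute the parameters and draw the samples. -/
def prepare : Prog :=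
  s ::= s +ₑ lit 1 ;; computeR ;; computeL ;; drawWords

/-- The algorithm on inputs with `40 * k ^ 2 < n`. -/
def greedyProg : Prog :=
  prepare ;; greedyRounds ;; n ::= n <ₑ i

/-- The algorithm. On short strings `SMALL` is always a correct answer. -/
def gapProg : Prog :=
  ite (lit 40 *ₑ k *ₑ k <ₑ n) greedyProg (n ::= lit SMALL)

/-- The parameters of the algorithm on the tape `τ`. The symbol `0` stands for the positions out of
range, hence the alphabet of size `σ + 1`. -/
def gapParams (n k σ : ℕ) (τ : ℕ → ℕ) : Params where
  n := n
  k := k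
  s := σ + 1
  r := Nat.sqrt k + 1
  L := 16 * (Nat.log 2 n + 1)
  words := tapeInit τ (numSamples k (16 * (Nat.log 2 n + 1)) n)
  pos := numSamples k (16 * (Nat.log 2 n + 1)) n

/-- Bound on the running time of the algorithm. -/
def timeBound (n k : ℕ) : ℕ :=
  2000 * ((Nat.log 2 n + 1) * (Nat.sqrt k + 1) * (16 * (Nat.log 2 n + 1))) *
    (2 * (2 * n + 1) / k + (k + 1))

theorem prepare_add_greedyRounds_le_timeBound (n k : ℕ) :
    20 * numSamples k (16 * (Nat.log 2 n + 1)) n + 20 * (Nat.sqrt k + 1) +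
      30 * (Nat.log 2 n + 1) + 1200 * ((Nat.log 2 n + 1) * (Nat.sqrt k + 1) *
        (16 * (Nat.log 2 n + 1))) * (2 * (2 * n + 1) / k + (k + 1)) + 100 ≤ timeBound n k := by
  unfold timeBound
  generalize Nat.log 2 n = e
  generalize Nat.sqrt k = r
  set D := (e + 1) * (r + 1) * (16 * (e + 1)) with hD
  set q := 2 * (2 * n + 1) / k + (k + 1)
  have hsamples : numSamples k (16 * (e + 1)) n ≤ D * q := by
    rw [mul_comm D]
    exact Nat.mul_le_mul (Nat.add_le_add (Nat.div_le_div_right (by omega)) k.succ_pos)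
      (Nat.le_mul_of_pos_left _ (Nat.mul_pos e.succ_pos r.succ_pos))
  have hDq : D ≤ D * q := Nat.le_mul_of_pos_right _ (Nat.add_pos_right _ k.succ_pos)
  have hr : 16 * (r + 1) ≤ D := by
    rw [hD, mul_comm 16]
    exact Nat.mul_le_mul (Nat.le_mul_of_pos_left _ e.succ_pos) (by omega)
  have he : 16 * (e + 1) ≤ D := Nat.le_mul_of_pos_left _ (Nat.mul_pos e.succ_pos r.succ_pos)
  rw [Nat.mul_assoc 2000, Nat.mul_assoc 1200]
  omega

theorem init_eq_toState {w n k σ : ℕ} (hn : n < 2 ^ w) (hk : k < 2 ^ w) (hσ : σ < 2 ^ w) :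
    init w n k σ = ({ n := n, k := k, s := σ } : Store).toState := by
  have hreg : (init w n k σ).reg = ({ n := n, k := k, s := σ } : Store).toState.reg := by
    funext x
    rcases x with _ | _ | _ | x
    · exact Nat.mod_eq_of_lt hn
    · exact Nat.mod_eq_of_lt hk
    · exact Nat.mod_eq_of_lt hσ
    · change 0 = (List.replicate 15 0).getD x 0
      rw [List.getD_eq_getElem?_getD, List.getElem?_replicate]
      split <;> rfl
  have harr : (init w n k σ).arr = ({ n := n, k := k, s := σ } : Store).toState.arr := by
    funext a
    simp only [init, Store.toState]
    split_ifs <;> rfl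
  exact congrArg₂ (fun f g => State.mk f g 0) hreg harr

theorem runs_prepare {n k σ : ℕ} (hn : n ≠ 0) (hk : (k + 2) * (k + 2) < E.size)
    (hV : (gapParams n k σ E.tape).Valid E) :
    Runs E prepare { n := n, k := k, s := σ } fun t v' =>
      t ≤ 20 * numSamples k (16 * (Nat.log 2 n + 1)) n + 20 * (Nat.sqrt k + 1) +
        30 * (Nat.log 2 n + 1) + 50 ∧ GreedyInv E (gapParams n k σ E.tape) 0 v' := by
  have hpos : 2 * n + 1 < E.size := by have := hV.pos_fits; simp only [gapParams] at this; omega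
  have hsamples : numSamples k (16 * (Nat.log 2 n + 1)) n + 1 < E.size := hV.numSamples_fits
  have hL : 16 * (Nat.log 2 n + 1) < E.size :=
    (Nat.le_mul_of_pos_left _ (Nat.succ_pos _)).trans_lt ((Nat.lt_succ_self _).trans hsamples)
  have hσ : σ + 1 < E.size :=
    (Nat.le_mul_of_pos_left (σ + 1) (Nat.succ_pos _)).trans_lt hV.ctr_fits
  refine .seq (.assign (.seq ((runs_computeR
    (v := { n := n, k := k, s := σ + 1 }) hk).mono ?_))
    ⟨trivial, Nat.lt_of_le_of_lt (Nat.succ_pos σ) hσ, hσ⟩)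
  rintro t₁ _ ⟨ht₁, rfl⟩
  refine .seq ((runs_computeL (v := { n := n, k := k, s := σ + 1, r := Nat.sqrt k + 1 })
    hn hpos hL).mono ?_)
  rintro t₂ _ ⟨ht₂, rfl⟩
  refine (runs_drawWords (Nat.mul_pos (by decide) (Nat.succ_pos _)) hsamples rfl rfl).mono ?_
  rintro t₃ u ⟨ht₃, hu, hctr, htrie⟩
  have hi : u.i = 0 := congrArg (·.i) hu
  have hg : u.g = 0 := congrArg (·.g) hu
  refine ⟨?_, congrArg (·.toParams) hu, ?_, by omega, by omega, Nat.zero_le _, ?_, ?_⟩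
  · simp only [Expr.cost] at ht₁ ht₂ ht₃ ⊢
    omega
  · rw [hi, hg]; exact .zero
  · rw [hctr]; exact Nat.zero_le _
  · rw [hctr, htrie]
    exact ⟨fun _ _ => rfl, fun _ _ => rfl⟩

theorem runs_greedyProg {n k σ : ℕ} (hn : n ≠ 0) (hk : (k + 2) * (k + 2) < E.size)
    (hV : (gapParams n k σ E.tape).Valid E) :
    Runs E greedyProg { n := n, k := k, s := σ } fun t v' => t + 10 ≤ timeBound n k ∧
      IsGreedyAnswer ((gapParams n k σ E.tape).Passes E) n k (Nat.sqrt k + 1) v'.n := by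
  refine .seq ((runs_prepare hn hk hV).mono ?_)
  rintro t₁ u ⟨ht₁, hinv⟩
  refine .seq ((runs_greedyRounds hV hinv).mono ?_)
  rintro t₂ u' ⟨τ, hinv', ht₂, hexit⟩
  have hn' : u'.n = n := congrArg (·.n) hinv'.params
  have hsize : 1 < E.size := by have := hV.pos_fits; omega
  refine .assign ⟨?_, u'.g, u'.i, hinv'.rounds, ?_⟩ (fits_lt trivial trivial hsize)
  · have hi := hinv'.i_le
    have hle := Nat.add_le_add (Nat.div_le_div_right (c := k) (Nat.mul_le_mul_left 2 hi)) hinv'.g_le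
    have hτ := hinv'.time.trans (Nat.mul_le_mul_left _ hle)
    have hmul : 600 * (2 * (Nat.log 2 n + 1) * ((Nat.sqrt k + 1) * (16 * (Nat.log 2 n + 1)))) =
      1200 * ((Nat.log 2 n + 1) * (Nat.sqrt k + 1) * (16 * (Nat.log 2 n + 1))) := by ring
    have hsum := prepare_add_greedyRounds_le_timeBound n k
    simp only [gapParams, Params.maxTests, hmul] at hτ
    simp only [Expr.cost] at ht₁ ht₂ ⊢
    omega
  · simp only [Store.set, value, Op.apply, Store.toState_reg, Store.get, hn']
    by_cases hlt : n < u'.i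
    · exact .inl ⟨hlt, hinv'.g_le, if_pos hlt⟩
    · exact .inr ⟨not_lt.1 hlt, hexit.resolve_left hlt, if_neg hlt⟩

theorem fits_gapProg_condition {v : Store} (hsize : 40 * v.k ^ 2 + 40 < E.size) :
    Expr.Fits E v.toState (lit 40 *ₑ k *ₑ k <ₑ n) := by
  have hk := Nat.mul_le_mul_left 40 (Nat.le_mul_self v.k)
  rw [pow_two] at hsize
  refine fits_lt ⟨⟨?_, trivial, ?_⟩, trivial, ?_⟩ trivial (by omega) <;>
    simp only [Expr.Fits, value, Op.apply, Store.toState_reg, Store.get, mul_assoc] <;>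
    omega

theorem value_gapProg_condition_ne_zero {v : Store} :
    value E v.toState (lit 40 *ₑ k *ₑ k <ₑ n) ≠ 0 ↔ 40 * v.k ^ 2 < v.n := by
  rw [pow_two, ← mul_assoc]
  exact value_lt_ne_zero

theorem runs_gapProg_of_lt {n k σ : ℕ} (hkn : 40 * k ^ 2 < n) (hsize : 40 * k ^ 2 + 40 < E.size)
    (hV : (gapParams n k σ E.tape).Valid E) :
    Runs E gapProg { n := n, k := k, s := σ } fun t v' => t ≤ timeBound n k ∧
      IsGreedyAnswer ((gapParams n k σ E.tape).Passes E) n k (Nat.sqrt k + 1) v'.n := by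
  refine .ite (fun _ => ?_) (fun h => absurd h (value_gapProg_condition_ne_zero.2 hkn))
    (fits_gapProg_condition hsize)
  refine (runs_greedyProg (Nat.ne_zero_of_lt hkn) (by nlinarith) hV).mono
    fun t v' ⟨_, h⟩ => ⟨?_, h⟩
  simp only [Expr.cost]
  omega

theorem runs_gapProg_of_le {n k σ : ℕ} (hn : n ≤ 40 * k ^ 2) (hsize : 40 * k ^ 2 + 40 < E.size) :
    Runs E gapProg { n := n, k := k, s := σ } fun t v' => t ≤ 10 ∧ v'.n = SMALL := by
  refine .ite (fun h => absurd (value_gapProg_condition_ne_zero.1 h) (not_lt.2 hn))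
    (fun _ => .assign ⟨by simp only [Expr.cost]; omega, rfl⟩ ?_) (fits_gapProg_condition hsize)
  exact Nat.lt_of_le_of_lt (show 1 ≤ 40 * k ^ 2 + 40 by omega) hsize

end WordRAM

namespace GapED

open Finset

/-- `∏ (1 - p) ≤ exp (-p m)`. -/
theorem card_avoid_le {ι β : Type*} [Fintype ι] [DecidableEq ι] [Fintype β] [DecidableEq β]
    (J : Finset ι) (H : Finset β) {p : ℝ} (hp : p * Fintype.card β ≤ #H) :
    (#{ω : ι → β | ∀ j ∈ J, ω j ∉ H} : ℝ) ≤
      Real.exp (-(p * #J)) * (Fintype.card β : ℝ) ^ Fintype.card ι := by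
  have hset : ({ω : ι → β | ∀ j ∈ J, ω j ∉ H} : Finset _) =
      Fintype.piFinset fun j => if j ∈ J then Hᶜ else univ := by
    ext ω
    simp only [mem_filter_univ, Fintype.mem_piFinset]
    exact forall_congr' fun j => by split_ifs with h <;> simp [h]
  have hcompl : (#Hᶜ : ℝ) ≤ Real.exp (-p) * Fintype.card β := by
    rw [card_compl, Nat.cast_sub (card_le_univ H)]
    have := mul_le_mul_of_nonneg_right (Real.add_one_le_exp (-p)) (Fintype.card β).cast_nonneg
    linarith
  calc (#{ω : ι → β | ∀ j ∈ J, ω j ∉ H} : ℝ)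
    _ = ∏ j, (#(if j ∈ J then Hᶜ else univ) : ℝ) := by
      rw [hset, Fintype.card_piFinset, Nat.cast_prod]
    _ ≤ ∏ j, (if j ∈ J then Real.exp (-p) else 1) * (Fintype.card β : ℝ) := by
      refine prod_le_prod (fun _ _ => Nat.cast_nonneg _) fun j _ => ?_
      split_ifs
      · exact hcompl
      · rw [one_mul, card_univ]
    _ = Real.exp (-(p * #J)) * (Fintype.card β : ℝ) ^ Fintype.card ι := by
      rw [prod_mul_distrib, prod_ite_mem, univ_inter, prod_const, prod_const, card_univ,
        ← Real.exp_nat_mul, mul_neg, mul_comm p]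

theorem card_mul_div_le_card_mod_mem (W : ℕ) {l : ℕ} (hl : 0 < l) {S : Finset ℕ}
    (hS : S ⊆ range l) : #S * (W / l) ≤ #{u : Fin W | (u : ℕ) % l ∈ S} := by
  have hmaps : ∀ u ∈ ({u : Fin W | (u : ℕ) % l ∈ S} : Finset _), (u : ℕ) % l ∈ S :=
    fun u hu => (mem_filter_univ u).1 hu
  rw [card_eq_sum_card_fiberwise hmaps, ← smul_eq_mul]
  refine card_nsmul_le_sum _ _ _ fun x hx => ?_
  rw [← card_map Fin.valEmbedding]
  have hxl : x < l := mem_range.1 (hS hx)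
  refine le_card_of_inj_on_range (fun q => x + l * q) (fun q hq => ?_) fun q _ q' _ h =>
    Nat.eq_of_mul_eq_mul_left hl (Nat.add_left_cancel h)
  have hmod : (x + l * q) % l = x := by rw [Nat.add_mul_mod_self_left, Nat.mod_eq_of_lt hxl]
  have hlt : x + l * q < W := by
    have hq' : l * (q + 1) ≤ W := (Nat.mul_le_mul_left _ hq).trans (Nat.mul_div_le W l)
    rw [Nat.mul_succ] at hq'
    omega
  exact mem_map.2
    ⟨⟨x + l * q, hlt⟩, mem_filter.2 ⟨(mem_filter_univ _).2 (hmod.symm ▸ hx), hmod⟩, rfl⟩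

theorem div_mul_le_card_mod_mem {W l : ℕ} (hl : 0 < l) (hlW : l ≤ W) {S : Finset ℕ}
    (hS : S ⊆ range l) : (#S : ℝ) / (2 * l) * W ≤ #{u : Fin W | (u : ℕ) % l ∈ S} := by
  have hW : W ≤ 2 * l * (W / l) := by
    have hdiv := Nat.div_add_mod W l
    have hmod := Nat.mod_lt W hl
    have hone : l * 1 ≤ l * (W / l) := Nat.mul_le_mul_left _ (Nat.div_pos hlW hl)
    rw [mul_assoc]
    omega
  have : (0 : ℝ) < l := Nat.cast_pos.2 hl
  calc (#S : ℝ) / (2 * l) * W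
    _ ≤ #S / (2 * l) * (2 * l * (W / l : ℕ)) := by
      gcongr
      exact_mod_cast hW
    _ = #S * (W / l : ℕ) := by field_simp
    _ ≤ _ := by exact_mod_cast card_mul_div_le_card_mod_mem W hl hS

theorem mul_le_mul_numSamples {k : ℕ} (hk : 0 < k) (L l : ℕ) : l * L ≤ k * numSamples k L l := by
  rw [numSamples, ← mul_assoc]
  exact Nat.mul_le_mul_right _ (Nat.lt_mul_div_succ l hk).le

/-- A sample falls into a set of more than `k` of the `l` residues with probability at least
`k / (2 * l)`, and `L` samples are taken per `k` positions. -/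
theorem card_miss_le {T W k L l : ℕ} {S : Finset ℕ} (hk : 0 < k) (hS : S ⊆ range l)
    (hkS : k < #S) (hlW : l ≤ W) (hT : numSamples k L l ≤ T) :
    (#{ω : Fin T → Fin W | ∀ j : Fin T, (j : ℕ) < numSamples k L l → (ω j : ℕ) % l ∉ S} : ℝ) ≤
      Real.exp (-(L / 2)) * (W : ℝ) ^ T := by
  have hl : 0 < l := (Nat.zero_lt_of_lt hkS).trans_le ((card_le_card hS).trans (card_range l).le)
  have : (0 : ℝ) < l := Nat.cast_pos.2 hl
  have hfrac : (k : ℝ) / (2 * l) * W ≤ #{u : Fin W | (u : ℕ) % l ∈ S} :=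
    le_trans (by gcongr) (div_mul_le_card_mod_mem hl hlW hS)
  have havoid := card_avoid_le {j : Fin T | (j : ℕ) < numSamples k L l}
    {u : Fin W | (u : ℕ) % l ∈ S} (by rwa [Fintype.card_fin])
  simp only [mem_filter_univ, Fintype.card_fin, Fin.card_filter_val_lt, min_eq_right hT] at havoid
  refine havoid.trans ?_
  have hsamples : (l : ℝ) * L ≤ k * numSamples k L l := by
    exact_mod_cast mul_le_mul_numSamples hk L l
  have hexp : (L : ℝ) / 2 ≤ k / (2 * l) * numSamples k L l := by
    rw [div_mul_eq_mul_div, div_le_div_iff₀ two_pos (by positivity)]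
    linarith
  gcongr

open WordRAM

variable {n σ : ℕ}

theorem exp_neg_eight_mul_le {n e : ℕ} (hn : 0 < n) (he : n ≤ 2 ^ e) :
    Real.exp (-(8 * e)) ≤ 1 / (n : ℝ) ^ 8 := by
  have hexp : (n : ℝ) ≤ Real.exp e := by
    have htwo : (2 : ℝ) ≤ Real.exp 1 := by linarith [Real.add_one_le_exp (1 : ℝ)]
    calc (n : ℝ) ≤ 2 ^ e := by exact_mod_cast he
      _ ≤ Real.exp 1 ^ e := by gcongr
      _ = Real.exp e := Real.exp_one_pow e
  rw [Real.exp_neg, ← one_div, mul_comm, Real.exp_mul, Real.rpow_ofNat]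
  have : (0 : ℝ) < n := Nat.cast_pos.2 hn
  gcongr

open Classical in
theorem card_not_revealsMismatches_le {T W k L r : ℕ} (f g : ℕ → ℕ) (hk : 0 < k) (hnW : n ≤ W)
    (hT : numSamples k L n ≤ T) {R : (Fin T → Fin W) → ℕ → ℕ}
    (hR : ∀ ω (j : Fin T), (j : ℕ) < numSamples k L n → R ω j = ω j) :
    (#{ω | ¬RevealsMismatches f g n k r L (R ω)} : ℝ) ≤
      ((n + 1) * (n * (r * (2 * k + r + 1))) : ℕ) * (Real.exp (-(L / 2)) * (W : ℝ) ^ T) := by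
  let S (p : ℕ × ℕ × ℕ × ℕ) : Finset ℕ :=
    mismatches f (shiftBy k g) (p.1 + p.2.2.1) (p.1 + p.2.2.2) p.2.1
  let I : Finset (ℕ × ℕ × ℕ × ℕ) :=
    range (n + 1) ×ˢ Ioc 0 n ×ˢ range r ×ˢ range (2 * k + r + 1)
  let miss (p : ℕ × ℕ × ℕ × ℕ) : Finset (Fin T → Fin W) :=
    {ω | ∀ j : Fin T, (j : ℕ) < numSamples k L p.2.1 → (ω j : ℕ) % p.2.1 ∉ S p}
  have hsub : ({ω | ¬RevealsMismatches f g n k r L (R ω)} : Finset _) ⊆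
      {p ∈ I | k < #(S p)}.biUnion miss := fun ω hω => by
    have hω := (mem_filter_univ ω).1 hω
    unfold RevealsMismatches at hω
    push Not at hω
    obtain ⟨i, hi, l, hl, hln, b, hb, y, hy, hcard, hmiss⟩ := hω
    refine mem_biUnion.2 ⟨(i, l, b, y), mem_filter.2 ⟨?_, hcard⟩, (mem_filter_univ ω).2 ?_⟩
    · simp only [I, mem_product, mem_range, mem_Ioc]
      omega
    · intro j hj
      rw [← hR ω j (hj.trans_le (numSamples_mono k L hln))]
      exact hmiss j hj
  have hmiss : ∀ p ∈ {p ∈ I | k < #(S p)},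
      (#(miss p) : ℝ) ≤ Real.exp (-(L / 2)) * (W : ℝ) ^ T := fun p hp => by
    obtain ⟨hpI, hcard⟩ := mem_filter.1 hp
    have hl : p.2.1 ≤ n := (mem_Ioc.1 (mem_product.1 (mem_product.1 hpI).2).1).2
    exact card_miss_le hk (filter_subset _ _) hcard (hl.trans hnW)
      ((numSamples_mono k L hl).trans hT)
  have hI : #{p ∈ I | k < #(S p)} ≤ (n + 1) * (n * (r * (2 * k + r + 1))) :=
    (card_filter_le _ _).trans (by simp [I])
  calc (#{ω | ¬RevealsMismatches f g n k r L (R ω)} : ℝ)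
    _ ≤ ∑ p ∈ I with k < #(S p), (#(miss p) : ℝ) := by
      exact_mod_cast (card_le_card hsub).trans card_biUnion_le
    _ ≤ #{p ∈ I | k < #(S p)} • (Real.exp (-(L / 2)) * (W : ℝ) ^ T) :=
      sum_le_card_nsmul _ _ _ hmiss
    _ ≤ _ := by
      rw [nsmul_eq_mul]
      gcongr

theorem card_windows_mul_exp_neg_le {n k r e : ℕ} (hn : 2 ≤ n) (hr : 2 * k + r + 1 ≤ n)
    (he : n ≤ 2 ^ e) :
    ((n + 1) * (n * (r * (2 * k + r + 1))) : ℕ) * Real.exp (-(8 * e)) ≤ 1 / n := by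
  have hcard : (n + 1) * (n * (r * (2 * k + r + 1))) ≤ n ^ 5 := by
    calc (n + 1) * (n * (r * (2 * k + r + 1))) ≤ (n * n) * (n * (n * n)) := by
          gcongr
          · nlinarith
          · omega
      _ = n ^ 5 := by ring
  have hnr : (1 : ℝ) ≤ n := by exact_mod_cast one_le_two.trans hn
  calc ((n + 1) * (n * (r * (2 * k + r + 1))) : ℕ) * Real.exp (-(8 * e))
    _ ≤ (n : ℝ) ^ 5 * (1 / n ^ 8) := by
      gcongr
      · exact_mod_cast hcard
      · exact exp_neg_eight_mul_le (by omega) he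
    _ = 1 / (n : ℝ) ^ 3 := by field_simp
    _ ≤ 1 / n := one_div_le_one_div_of_le (by linarith) (le_self_pow₀ hnr (by decide))

end GapED

namespace WordRAM

open Finset GapED

variable {n σ T w k r : ℕ} {P : Prog} {A B : Fin n → Fin σ}

open Classical in
theorem one_sub_le_answerProb {good : (Fin T → Fin (2 ^ w)) → Prop} {δ : ℝ}
    (hgood : ∀ ω, good ω → Answers P w k A B r ω)
    (hbad : (#{ω | ¬good ω} : ℝ) ≤ δ * ((2 ^ w : ℕ) : ℝ) ^ T) :
    1 - δ ≤ answerProb P w k T A B r := by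
  have hpos : (0 : ℝ) < ((2 ^ w : ℕ) : ℝ) ^ T := by positivity
  have hsplit : #{ω | good ω} + #{ω | ¬good ω} = (2 ^ w) ^ T := by
    rw [card_filter_add_card_filter_not, card_univ, Fintype.card_fun, Fintype.card_fin,
      Fintype.card_fin]
  have hsub : #{ω | good ω} ≤ #{ω : Fin T → Fin (2 ^ w) | Answers P w k A B r ω} :=
    card_le_card (monotone_filter_right _ fun ω _ => hgood ω)
  have hcount : ((2 ^ w : ℕ) : ℝ) ^ T ≤
      #{ω : Fin T → Fin (2 ^ w) | Answers P w k A B r ω} + #{ω | ¬good ω} := by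
    exact_mod_cast hsplit.symm.le.trans (Nat.add_le_add_right hsub _)
  rw [answerProb, Nat.card_eq_fintype_card, Nat.card_eq_fintype_card, Fintype.card_subtype,
    Fintype.card_fun, Fintype.card_fin, Fintype.card_fin, Nat.cast_pow, le_div_iff₀ hpos]
  linarith

theorem answerProb_eq_one (h : ∀ ω : Fin T → Fin (2 ^ w), Answers P w k A B r ω) :
    answerProb P w k T A B r = 1 := by
  have : Nonempty (Fin T → Fin (2 ^ w)) := ⟨fun _ => ⟨0, Nat.two_pow_pos w⟩⟩
  rw [answerProb, Nat.card_congr (Equiv.subtypeUnivEquiv h),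
    div_self (Nat.cast_ne_zero.2 Nat.card_pos.ne')]

open GapED

section Parameters

variable {E : Env} {n k σ w : ℕ}

theorem lt_two_pow_log_add_log (n σ : ℕ) :
    n < 2 ^ (Nat.log 2 n + Nat.log 2 σ + 1) ∧ σ < 2 ^ (Nat.log 2 n + Nat.log 2 σ + 1) :=
  ⟨(Nat.lt_pow_succ_log_self one_lt_two n).trans_le (Nat.pow_le_pow_right two_pos (by omega)),
    (Nat.lt_pow_succ_log_self one_lt_two σ).trans_le (Nat.pow_le_pow_right two_pos (by omega))⟩

theorem numSamples_le_pow {Y : ℕ} (hn : n ≠ 0) (hY : 16 ≤ Y) (hnY : n < Y) :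
    numSamples k (16 * (Nat.log 2 n + 1)) n ≤ Y ^ 3 := by
  have hdiv := Nat.div_le_self n k
  have hlog := Nat.log_lt_self 2 hn
  calc (n / k + 1) * (16 * (Nat.log 2 n + 1)) ≤ Y * (Y * Y) := by gcongr <;> omega
    _ = Y ^ 3 := by ring

theorem trieNodes_mul_alphabet_le_pow {Y : ℕ} (hn : n ≠ 0) (hY : 16 ≤ Y) (hkY : k < Y)
    (hnY : n < Y) (hσY : σ < Y) :
    ((k + 1) * (2 * (Nat.log 2 n + 1) *
      ((Nat.sqrt k + 1) * numSamples k (16 * (Nat.log 2 n + 1)) n + 1)) + 2) * (σ + 1)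
        ≤ Y ^ 10 := by
  have hlog := Nat.log_lt_self 2 hn
  have hsqrt := Nat.sqrt_le_self k
  have hsucc : ∀ m, Y ^ m + 2 ≤ Y ^ (m + 1) := fun m => by
    have := Nat.pow_pos (n := m) (show 0 < Y by omega)
    rw [pow_succ]
    nlinarith
  have hnodes : (Nat.sqrt k + 1) * numSamples k (16 * (Nat.log 2 n + 1)) n + 1 ≤ Y ^ 5 := by
    have : (Nat.sqrt k + 1) * numSamples k (16 * (Nat.log 2 n + 1)) n ≤ Y * Y ^ 3 :=
      Nat.mul_le_mul (by omega) (numSamples_le_pow hn hY hnY)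
    rw [← pow_succ'] at this
    exact (Nat.add_le_add_right this 1).trans ((Nat.le_succ _).trans (hsucc 4))
  have hall : (k + 1) * (2 * (Nat.log 2 n + 1) *
      ((Nat.sqrt k + 1) * numSamples k (16 * (Nat.log 2 n + 1)) n + 1)) ≤ Y ^ 8 := by
    calc _ ≤ Y * (Y * Y * Y ^ 5) := by gcongr <;> omega
      _ = Y ^ 8 := by ring
  calc _ ≤ Y ^ 9 * Y := Nat.mul_le_mul ((Nat.add_le_add_right hall 2).trans (hsucc 8)) hσY
    _ = Y ^ 10 := by ring

theorem valid_gapParams (hkn : 40 * k ^ 2 < n) (hk : 0 < k)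
    (hw : 30 * (Nat.log 2 n + Nat.log 2 σ + 1) ≤ E.w)
    (hA : ∀ x, E.strA x < σ + 1) (hB : ∀ x, E.strB x < σ + 1) :
    (gapParams n k σ E.tape).Valid E := by
  obtain ⟨hnY, hσY⟩ := lt_two_pow_log_add_log n σ
  set Y := 2 ^ (Nat.log 2 n + Nat.log 2 σ + 1) with hY
  have hYw : Y ^ 11 ≤ E.size := by
    rw [hY, ← pow_mul]
    exact Nat.pow_le_pow_right two_pos (by omega)
  have hkk : k ≤ k ^ 2 := Nat.le_self_pow two_ne_zero k
  have hsqrt := Nat.sqrt_le_self k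
  have hn : n ≠ 0 := Nat.ne_zero_of_lt hkn
  have hpow : ∀ m < 11, Y ^ m + 1 ≤ Y ^ 11 := fun m hm => Nat.pow_lt_pow_right (by omega) hm
  refine ⟨hA, hB, Nat.lt_succ_sqrt k, ?_, Nat.mul_pos (by decide) (Nat.succ_pos _), ?_, ?_, ?_⟩
  · change Nat.sqrt k + 1 ≤ n
    omega
  · change 2 * n + 2 * k + 2 * (Nat.sqrt k + 1) + 5 < E.size
    have : 16 * Y ≤ Y ^ 2 := by rw [pow_two]; exact Nat.mul_le_mul_right _ (by omega)
    have := hpow 2 (by decide)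
    omega
  · have hsamples : numSamples k (16 * (Nat.log 2 n + 1)) n ≤ Y ^ 3 :=
      numSamples_le_pow hn (by omega) hnY
    have : Y ^ 3 < Y ^ 4 := Nat.pow_lt_pow_right (by omega) (by decide)
    have := hpow 4 (by decide)
    change numSamples k (16 * (Nat.log 2 n + 1)) n + 1 < E.size
    omega
  · exact (trieNodes_mul_alphabet_le_pow (k := k) hn (by omega) (by omega) hnY hσY).trans_lt
      ((hpow 10 (by decide)).trans hYw)

theorem bounds_lt_two_pow_of_le_mul_sqrt {κ : ℕ} {K : ℝ} (hn : 1 ≤ n)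
    (hkK : (k : ℝ) ≤ K * √(n : ℝ)) (hκ : 40 * K ^ 2 + 40 < (2 : ℝ) ^ κ)
    (hw : (κ + 1) * (Nat.log 2 n + Nat.log 2 σ + 1) ≤ w) :
    40 * k ^ 2 + 40 < 2 ^ w ∧ n < 2 ^ w ∧ σ < 2 ^ w := by
  obtain ⟨hnY, hσY⟩ := lt_two_pow_log_add_log n σ
  set a := Nat.log 2 n + Nat.log 2 σ + 1 with ha
  have haw : κ + a ≤ w := by
    have := Nat.le_mul_of_pos_right κ (show 0 < a by omega)
    rw [Nat.add_mul] at hw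
    omega
  have hpow : 2 ^ a ≤ 2 ^ w := Nat.pow_le_pow_right two_pos (by omega)
  refine ⟨?_, hnY.trans_le hpow, hσY.trans_le hpow⟩
  have hnr : (1 : ℝ) ≤ n := by exact_mod_cast hn
  have hk2 : (k : ℝ) ^ 2 ≤ K ^ 2 * n := by
    calc (k : ℝ) ^ 2 ≤ (K * √(n : ℝ)) ^ 2 := pow_le_pow_left₀ (by positivity) hkK 2
      _ = K ^ 2 * n := by rw [mul_pow, Real.sq_sqrt (by positivity)]
  have : 40 * (k : ℝ) ^ 2 + 40 < (2 : ℝ) ^ w := by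
    calc (40 * (k : ℝ) ^ 2 + 40 : ℝ) ≤ (40 * K ^ 2 + 40) * n := by nlinarith
      _ < (2 : ℝ) ^ κ * n := by gcongr
      _ ≤ (2 : ℝ) ^ κ * (2 : ℝ) ^ a := by
        gcongr
        exact_mod_cast hnY.le
      _ = (2 : ℝ) ^ (κ + a) := (pow_add _ _ _).symm
      _ ≤ (2 : ℝ) ^ w := pow_le_pow_right₀ one_le_two haw
  exact_mod_cast this

end Parameters

section TimeBound

variable {n k : ℕ}

theorem log_two_add_one_le (hn : n ≠ 0) :
    ((Nat.log 2 n : ℕ) : ℝ) + 1 ≤ 4 * Real.log (n + 1) := by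
  have hpow : (2 : ℝ) ^ (Nat.log 2 n + 1) ≤ ((n : ℝ) + 1) ^ 2 := by
    have := Nat.pow_log_le_self 2 hn
    have : 2 ^ (Nat.log 2 n + 1) ≤ (n + 1) ^ 2 := by
      rw [pow_succ]
      nlinarith
    exact_mod_cast this
  have hlog := Real.log_le_log (by positivity) hpow
  rw [Real.log_pow, Real.log_pow] at hlog
  push_cast at hlog
  nlinarith [Real.log_two_gt_d9, (Nat.log 2 n).cast_nonneg (α := ℝ)]

theorem sqrt_add_one_le (hk : 1 ≤ k) : (Nat.sqrt k : ℝ) + 1 ≤ 2 * √(k : ℝ) := by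
  have hfloor : (Nat.sqrt k : ℝ) ≤ √(k : ℝ) := Real.nat_sqrt_le_real_sqrt
  have hone : 1 ≤ √(k : ℝ) := Real.one_le_sqrt.2 (by exact_mod_cast hk)
  linarith

theorem div_add_succ_le (hk : 1 ≤ k) (hkn : 40 * k ^ 2 < n) :
    ((2 * (2 * n + 1) / k : ℕ) : ℝ) + (k + 1) ≤ 7 * (n / k) := by
  have hkr : (1 : ℝ) ≤ k := by exact_mod_cast hk
  have hnr : 40 * (k : ℝ) ^ 2 ≤ n := by exact_mod_cast hkn.le
  have hdiv : ((2 * (2 * n + 1) / k : ℕ) : ℝ) ≤ 6 * (n / k) := by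
    refine Nat.cast_div_le.trans ?_
    rw [← mul_div_assoc]
    gcongr
    push_cast
    nlinarith
  have hk1 : (k : ℝ) + 1 ≤ n / k := by
    rw [le_div_iff₀ (by linarith)]
    nlinarith
  linarith

theorem timeBound_le (hk : 1 ≤ k) (hkn : 40 * k ^ 2 < n) :
    (timeBound n k : ℝ) ≤ 7168000 * ((n : ℝ) / √(k : ℝ)) * Real.log ((n : ℝ) + 1) ^ 2 := by
  have hlog := log_two_add_one_le (Nat.ne_zero_of_lt hkn)
  have hsqrt := sqrt_add_one_le hk
  have hdiv := div_add_succ_le hk hkn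
  have hk0 : √(k : ℝ) ≠ 0 := Real.sqrt_ne_zero'.2 (by exact_mod_cast hk)
  calc (timeBound n k : ℝ)
    _ = 32000 * ((Nat.log 2 n : ℕ) + 1) ^ 2 *
        (((Nat.sqrt k : ℕ) + 1) * (((2 * (2 * n + 1) / k : ℕ) : ℝ) + (k + 1))) := by
      rw [timeBound]
      push_cast
      ring
    _ ≤ 32000 * (4 * Real.log (n + 1)) ^ 2 * (2 * √(k : ℝ) * (7 * (n / k))) := by gcongr
    _ = 7168000 * (√(k : ℝ) * (n / (√(k : ℝ) * √(k : ℝ)))) * Real.log (n + 1) ^ 2 := by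
      rw [Real.mul_self_sqrt k.cast_nonneg]
      ring
    _ = 7168000 * ((n : ℝ) / √(k : ℝ)) * Real.log (n + 1) ^ 2 := by
      rw [mul_div, mul_div_mul_left _ _ hk0]

theorem ten_le_bound {K : ℝ} (hn : 1 ≤ n) (hk : 1 ≤ k) (hkK : (k : ℝ) ≤ K * √(n : ℝ)) :
    (10 : ℝ) ≤ 40 * |K| * ((n : ℝ) / √(k : ℝ)) * Real.log ((n : ℝ) + 1) ^ 2 := by
  have hkr : (1 : ℝ) ≤ k := by exact_mod_cast hk
  have hnr : (1 : ℝ) ≤ n := by exact_mod_cast hn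
  have hratio : 1 ≤ |K| * ((n : ℝ) / √(k : ℝ)) := by
    rw [← mul_div_assoc, one_le_div (by positivity)]
    calc √(k : ℝ) ≤ k := Real.sqrt_le_self_iff.2 (.inr hkr)
      _ ≤ K * √(n : ℝ) := hkK
      _ ≤ |K| * n := mul_le_mul (le_abs_self K) (Real.sqrt_le_self_iff.2 (.inr hnr))
        (Real.sqrt_nonneg _) (abs_nonneg K)
  have hlog : (1 : ℝ) / 2 ≤ Real.log (n + 1) := by
    have : Real.log 2 ≤ Real.log (n + 1) := Real.log_le_log two_pos (by linarith)
    linarith [Real.log_two_gt_d9]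
  calc (10 : ℝ) = 40 * 1 * (1 / 2) ^ 2 := by norm_num
    _ ≤ 40 * (|K| * ((n : ℝ) / √(k : ℝ))) * Real.log ((n : ℝ) + 1) ^ 2 := by gcongr
    _ = _ := by ring

end TimeBound

/-- With word length `w` and `T` random words, `P` halts within `T` steps with one of the two
answers, and tells apart strings of edit distance at most `k` and more than `40 * k ^ 2` with
probability at least `1 - 1 / n`. -/
def SolvesGap (P : Prog) (n k σ w T : ℕ) : Prop :=
  ∀ A B : Fin n → Fin σ,
    (∀ ω : Fin T → Fin (2 ^ w), Answers P w k A B SMALL ω ∨ Answers P w k A B LARGE ω) ∧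
    (ED A B ≤ k → 1 - 1 / (n : ℝ) ≤ answerProb P w k T A B SMALL) ∧
    (40 * k ^ 2 < ED A B → 1 - 1 / (n : ℝ) ≤ answerProb P w k T A B LARGE)

section SolvesGap

variable {n k σ w T : ℕ} {A B : Fin n → Fin σ} {ω : Fin T → Fin (2 ^ w)}

theorem exists_answers_of_runs {P : Prog} {p : ℕ → Prop} (hn : n < 2 ^ w) (hk : k < 2 ^ w)
    (hσ : σ < 2 ^ w)
    (h : Runs (env w A B ω) P { n := n, k := k, s := σ } fun t v => t ≤ T ∧ p v.n) :
    ∃ x, p x ∧ Answers P w k A B x ω := by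
  obtain ⟨t, v, hexec, ht, hp⟩ := h
  exact ⟨v.n, hp, t, ht, v.toState, init_eq_toState hn hk hσ ▸ hexec, rfl⟩

theorem exists_answers_gapProg (hk : 0 < k) (hkn : 40 * k ^ 2 < n)
    (hw : 30 * (Nat.log 2 n + Nat.log 2 σ + 1) ≤ w) (A B : Fin n → Fin σ)
    (ω : Fin (timeBound n k) → Fin (2 ^ w)) :
    ∃ x, IsGreedyAnswer (Passes (readString A) (readString B) k (Nat.sqrt k + 1)
        (16 * (Nat.log 2 n + 1)) (gapParams n k σ (env w A B ω).tape).words)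
        n k (Nat.sqrt k + 1) x ∧ Answers gapProg w k A B x ω := by
  have hV := valid_gapParams (E := env w A B ω) hkn hk hw (readString_lt A) (readString_lt B)
  have hsize : 2 * n + 2 * k + 2 * (Nat.sqrt k + 1) + 5 < 2 ^ w := hV.pos_fits
  have hσ : σ + 1 < 2 ^ w := (Nat.le_mul_of_pos_left _ (Nat.succ_pos _)).trans_lt hV.ctr_fits
  have hkk : k ≤ k ^ 2 := Nat.le_self_pow two_ne_zero k
  refine exists_answers_of_runs (by omega) (by omega) (by omega) (runs_gapProg_of_lt hkn ?_ hV)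
  change 40 * k ^ 2 + 40 < 2 ^ w
  omega

open Classical in
theorem card_not_revealsMismatches_gapParams_le (hk : 0 < k) (hkn : 40 * k ^ 2 < n)
    (hnw : n ≤ 2 ^ w) (A B : Fin n → Fin σ) :
    (Finset.card {ω : Fin (timeBound n k) → Fin (2 ^ w) |
      ¬RevealsMismatches (readString A) (readString B) n k (Nat.sqrt k + 1)
        (16 * (Nat.log 2 n + 1)) (gapParams n k σ (env w A B ω).tape).words} : ℝ) ≤
      1 / n * ((2 ^ w : ℕ) : ℝ) ^ timeBound n k := by
  have hsamples : numSamples k (16 * (Nat.log 2 n + 1)) n ≤ timeBound n k := by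
    have := prepare_add_greedyRounds_le_timeBound n k
    omega
  have hkk : k ≤ k ^ 2 := Nat.le_self_pow two_ne_zero k
  have hsqrt := Nat.sqrt_le_self k
  refine (card_not_revealsMismatches_le _ _ hk hnw hsamples fun ω j hj => ?_).trans ?_
  · simp only [gapParams, tapeInit, if_pos hj, env, dif_pos j.isLt]
  · have hhalf : ((16 * (Nat.log 2 n + 1) : ℕ) : ℝ) / 2 = 8 * ((Nat.log 2 n + 1 : ℕ) : ℝ) := by
      push_cast
      ring
    rw [hhalf, ← mul_assoc]
    gcongr
    exact card_windows_mul_exp_neg_le (by omega) (by omega)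
      (Nat.lt_pow_succ_log_self one_lt_two n).le

theorem solvesGap_gapProg_of_lt (hk : 0 < k) (hkn : 40 * k ^ 2 < n)
    (hw : 30 * (Nat.log 2 n + Nat.log 2 σ + 1) ≤ w) :
    SolvesGap gapProg n k σ w (timeBound n k) := fun A B => by
  have hans := exists_answers_gapProg hk hkn hw A B
  refine ⟨fun ω => ?_, fun hED => ?_, fun hED => ?_⟩
  · obtain ⟨x, hx, h⟩ := hans ω
    rcases hx.eq_small_or_large with rfl | rfl
    · exact .inl h
    · exact .inr h
  · rw [answerProb_eq_one fun ω => ?_]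
    · exact sub_le_self _ (by positivity)
    · obtain ⟨x, hx, h⟩ := hans ω
      exact hx.eq_small (Nat.succ_pos _) hED ▸ h
  · have hnw : n ≤ 2 ^ w := (lt_two_pow_log_add_log n σ).1.le.trans
      (Nat.pow_le_pow_right two_pos (by omega))
    refine one_sub_le_answerProb (fun ω hreveals => ?_)
      (card_not_revealsMismatches_gapParams_le hk hkn hnw A B)
    obtain ⟨x, hx, h⟩ := hans ω
    refine hx.eq_large hreveals (lt_of_le_of_lt ?_ hED) ▸ h
    have hsqrt := Nat.sqrt_le_self k
    calc (k + 1) * (3 * k + 3 * (Nat.sqrt k + 1) + 2) ≤ 2 * k * (11 * k) :=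
          Nat.mul_le_mul (by omega) (by omega)
      _ ≤ 40 * k ^ 2 := by nlinarith

theorem solvesGap_gapProg_of_le (hn : n ≤ 40 * k ^ 2) (hk : 40 * k ^ 2 + 40 < 2 ^ w)
    (hnw : n < 2 ^ w) (hσ : σ < 2 ^ w) : SolvesGap gapProg n k σ w 10 := fun A B => by
  have hkk : k ≤ k ^ 2 := Nat.le_self_pow two_ne_zero k
  have hans : ∀ ω : Fin 10 → Fin (2 ^ w), Answers gapProg w k A B SMALL ω := fun ω => by
    obtain ⟨_, rfl, h⟩ := exists_answers_of_runs (p := (· = SMALL)) hnw (by omega) hσ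
      (runs_gapProg_of_le (E := env w A B ω) hn hk)
    exact h
  refine ⟨fun ω => .inl (hans ω), fun _ => ?_, fun hED => absurd ((ED_le A B).trans hn) hED.not_ge⟩
  rw [answerProb_eq_one hans]
  exact sub_le_self _ (by positivity)

end SolvesGap

end WordRAM

theorem mainTheorem1 :
    ∃ (P : WordRAM.Prog) (e : ℕ), ∀ K : ℝ, ∃ (C : ℝ) (c : ℕ),
      ∀ n k σ w : ℕ, 1 ≤ n → 1 ≤ k → (k : ℝ) ≤ K * √(n : ℝ) →
        c * (Nat.log 2 n + Nat.log 2 σ + 1) ≤ w →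
        ∃ T : ℕ, (T : ℝ) ≤ C * ((n : ℝ) / √(k : ℝ)) * Real.log ((n : ℝ) + 1) ^ e ∧
          ∀ A B : Fin n → Fin σ,
            (∀ ω : Fin T → Fin (2 ^ w),
              WordRAM.Answers P w k A B WordRAM.SMALL ω ∨
                WordRAM.Answers P w k A B WordRAM.LARGE ω) ∧
            (ED A B ≤ k →
              1 - 1 / (n : ℝ) ≤ WordRAM.answerProb P w k T A B WordRAM.SMALL) ∧
            (40 * k ^ 2 < ED A B →
              1 - 1 / (n : ℝ) ≤ WordRAM.answerProb P w k T A B WordRAM.LARGE) := by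
  refine ⟨WordRAM.gapProg, 2, fun K => ?_⟩
  obtain ⟨κ, hκ⟩ := pow_unbounded_of_one_lt (40 * K ^ 2 + 40) (one_lt_two : (1 : ℝ) < 2)
  refine ⟨7168000 + 40 * |K|, 30 + κ, fun n k σ w hn hk hkK hw => ?_⟩
  have hfactor : 0 ≤ (n : ℝ) / √(k : ℝ) * Real.log ((n : ℝ) + 1) ^ 2 := by positivity
  rcases lt_or_ge (40 * k ^ 2) n with hkn | hkn
  · refine ⟨WordRAM.timeBound n k, ?_, WordRAM.solvesGap_gapProg_of_lt hk hkn
      ((Nat.mul_le_mul_right _ (by omega)).trans hw)⟩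
    nlinarith [WordRAM.timeBound_le hk hkn, mul_nonneg (abs_nonneg K) hfactor]
  · obtain ⟨hkw, hnw, hσw⟩ := WordRAM.bounds_lt_two_pow_of_le_mul_sqrt hn hkK hκ
      ((Nat.mul_le_mul_right _ (by omega)).trans hw)
    refine ⟨10, ?_, WordRAM.solvesGap_gapProg_of_le hkn hkw hnw hσw⟩
    push_cast
    nlinarith [WordRAM.ten_le_bound hn hk hkK]
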